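/- Let $G$ be the Heisenberg group of real matrices $\left(\begin{smallmatrix} 1 & x & y\\ 0 & 1 & z\\ 0 & 0 & 1\end{smallmatrix}\right)$, let $\Gamma\le G$ be the subgroup of those with $x,y,z\in\mathbb{Z}$, and equip $G/\Gamma$ (left cosets $g\Gamma$) with its unique $G$-invariant Borel probability measure. Let $\psi:G\to\mathbb{R}^3$ be the Mal'cev coordinate map of the basis $X_1=E_{12}$, $X_2=E_{23}$, $X_3=E_{13}$ of the Lie algebra, that is, $g=\exp(t_1X_1)\exp(t_2X_2)\exp(t_3X_3)$ if and only if $\psi(g)=(t_1,t_2,t_3)$; explicitly, \[ \psi\left(\begin{smallmatrix} 1 & x & y\\ 0 & 1 & z\\ 0 & 0 & 1\end{smallmatrix}\right)=(x,\,z,\,y-xz). \] Write $|\cdot|$ for the $\ell^\infty$-norm on $\mathbb{R}^3$. Let $d$ be the largest metric on $G$ with $d(x,y)\le|\psi(xy^{-1})|$ for all $x,y\in G$, that is, \[ d(x,y)=\inf\Big\{\sum_{i=1}^{n}\min\big(|\psi(x_{i-1}x_i^{-1})|,|\psi(x_ix_{i-1}^{-1})|\big)\;:\; n\ge 0,\ x_0,\dots,x_n\in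 G,\ x_0=x,\ x_n=y\Big\}, \] and let $d(p,q)=\inf\{d(x,y): x\Gamma=p,\ y\Gamma=q\}$ for $p,q\in G/\Gamma$. For a Lipschitz function $F:G/\Gamma\to\mathbb{C}$ put $\|F\|_{\mathrm{Lip}}=\|F\|_\infty+\sup_{p\ne q}|F(p)-F(q)|/d(p,q)$. For $\delta>0$ and an integer $N\ge1$, a sequence $(g(n)\Gamma)_{1\le n\le N}$ is called $\delta$-equidistributed if \[ \Big|\frac1N\sum_{n=1}^N F(g(n)\Gamma)-\int_{G/\Gamma}F\Big|\le\delta\|F\|_{\mathrm{Lip}} \] for every Lipschitz function $F:G/\Gamma\to\mathbb{C}$. A horizontal character is a continuous homomorphism $\eta:G\to\mathbb{R}/\mathbb{Z}$ that annihilates $\Gamma$; it has the form $\eta(g)=k\cdot\psi(g) \bmod \mathbb{Z}$ for a unique $k\in\mathbb{Z}^3$, and $|\eta|:=|k|$. For $t\in\mathbb{R}/\mathbb{Z}$ let $\|t\|_{\mathbb{R}/\mathbb{Z}}$ be the distance of $t$ to $0$. \textbf{Proposition.} There are absolute constants $C,A>0$ such that the following holds for every $a\in G$, every $\delta>0$ and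 every integer $N\ge1$: either $(a^n\Gamma)_{1\le n\le N}$ is $\delta$-equidistributed in $G/\Gamma$, or there is a horizontal character $\eta$ with \[ 0<|\eta|\le C\delta^{-A}\qquad\text{and}\qquad \|\eta(a)\|_{\mathbb{R}/\mathbb{Z}}\le\frac{C\delta^{-A}}{N}. \] (The two alternatives need not exclude each other.) -/

import Mathlib

open MeasureTheory

noncomputable section

/-- The real Heisenberg group: the element `⟨x, y, z⟩` is the unipotent matrix
`(1 x y; 0 1 z; 0 0 1)`, see `Heis.toMatrix`. -/
@[ext]
structure Heis where
  x : ℝ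
  y : ℝ
  z : ℝ

namespace Heis

/-- The matrix of an element of the Heisenberg group. -/
def toMatrix (g : Heis) : Matrix (Fin 3) (Fin 3) ℝ :=
  !![1, g.x, g.y; 0, 1, g.z; 0, 0, 1]

instance : One Heis := ⟨⟨0, 0, 0⟩⟩
instance : Mul Heis := ⟨fun g h => ⟨g.x + h.x, g.y + g.x * h.z + h.y, g.z + h.z⟩⟩
instance : Inv Heis := ⟨fun g => ⟨-g.x, g.x * g.z - g.y, -g.z⟩⟩

@[simp] theorem one_x : (1 : Heis).x = 0 := rfl
@[simp] theorem one_y : (1 : Heis).y = 0 := rfl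
@[simp] theorem one_z : (1 : Heis).z = 0 := rfl
@[simp] theorem mul_x (g h : Heis) : (g * h).x = g.x + h.x := rfl
@[simp] theorem mul_y (g h : Heis) : (g * h).y = g.y + g.x * h.z + h.y := rfl
@[simp] theorem mul_z (g h : Heis) : (g * h).z = g.z + h.z := rfl
@[simp] theorem inv_x (g : Heis) : (g⁻¹).x = -g.x := rfl
@[simp] theorem inv_y (g : Heis) : (g⁻¹).y = g.x * g.z - g.y := rfl
@[simp] theorem inv_z (g : Heis) : (g⁻¹).z = -g.z := rfl

instance : Group Heis :=
  Group.ofLeftAxioms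
    (fun a b c => by ext <;> simp <;> ring)
    (fun a => by ext <;> simp)
    (fun a => by ext <;> simp; ring)

/-- The group law is matrix multiplication. -/
theorem toMatrix_mul (g h : Heis) : (g * h).toMatrix = g.toMatrix * h.toMatrix := by
  ext i j
  fin_cases i <;> fin_cases j <;>
    simp [toMatrix, Matrix.mul_apply, Fin.sum_univ_three] <;> ring

theorem toMatrix_one : (1 : Heis).toMatrix = 1 := by
  ext i j
  fin_cases i <;> fin_cases j <;> simp [toMatrix]

theorem toMatrix_injective : Function.Injective toMatrix := by
  intro g h hgh
  have h1 := congrFun (congrFun hgh 0) 1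
  have h2 := congrFun (congrFun hgh 0) 2
  have h3 := congrFun (congrFun hgh 1) 2
  ext
  · simpa [toMatrix] using h1
  · simpa [toMatrix] using h2
  · simpa [toMatrix] using h3

/-- The matrix entries `((x, z), y)` identify the Heisenberg group with `ℝ³` as a space. -/
def entries : Heis ≃ (ℝ × ℝ) × ℝ where
  toFun g := ((g.x, g.z), g.y)
  invFun p := ⟨p.1.1, p.2, p.1.2⟩
  left_inv _ := rfl
  right_inv _ := rfl

instance : TopologicalSpace Heis := TopologicalSpace.induced entries inferInstance
instance : MeasurableSpace Heis := MeasurableSpace.comap entries inferInstance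
instance : BorelSpace Heis := ⟨by
  change MeasurableSpace.comap entries _ = _
  rw [BorelSpace.measurable_eq (α := (ℝ × ℝ) × ℝ), borel_comap]⟩

/-- `entries` as a homeomorphism. -/
def entriesHomeo : Heis ≃ₜ (ℝ × ℝ) × ℝ := entries.toHomeomorphOfIsInducing ⟨rfl⟩

theorem continuous_x : Continuous Heis.x :=
  (continuous_fst.comp continuous_fst).comp entriesHomeo.continuous
theorem continuous_y : Continuous Heis.y :=
  continuous_snd.comp entriesHomeo.continuous
theorem continuous_z : Continuous Heis.z :=
  (continuous_snd.comp continuous_fst).comp entriesHomeo.continuous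

theorem continuous_of_entries {α : Type*} [TopologicalSpace α] {f : α → Heis}
    (hx : Continuous fun a => (f a).x) (hy : Continuous fun a => (f a).y)
    (hz : Continuous fun a => (f a).z) : Continuous f :=
  continuous_induced_rng.2 ((hx.prodMk hz).prodMk hy)

instance : IsTopologicalGroup Heis where
  continuous_mul := by
    have h1 := continuous_x.comp (continuous_fst (X := Heis) (Y := Heis))
    have h2 := continuous_y.comp (continuous_fst (X := Heis) (Y := Heis))
    have h3 := continuous_z.comp (continuous_fst (X := Heis) (Y := Heis))
    have k1 := continuous_x.comp (continuous_snd (X := Heis) (Y := Heis))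
    have k2 := continuous_y.comp (continuous_snd (X := Heis) (Y := Heis))
    have k3 := continuous_z.comp (continuous_snd (X := Heis) (Y := Heis))
    exact continuous_of_entries (h1.add k1) ((h2.add (h1.mul k3)).add k2) (h3.add k3)
  continuous_inv :=
    continuous_of_entries continuous_x.neg
      ((continuous_x.mul continuous_z).sub continuous_y) continuous_z.neg

instance : PolishSpace Heis := entriesHomeo.isClosedEmbedding.polishSpace

/-- Lebesgue measure in the matrix entries, a two-sided Haar measure of the Heisenberg group. -/
instance : MeasureSpace Heis := ⟨Measure.map entriesHomeo.symm volume⟩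

theorem measurePreserving_entries : MeasurePreserving entriesHomeo.toMeasurableEquiv :=
  MeasurePreserving.symm entriesHomeo.toMeasurableEquiv.symm
    ⟨entriesHomeo.toMeasurableEquiv.symm.measurable, rfl⟩

instance : Measure.IsMulLeftInvariant (volume : Measure Heis) where
  map_mul_left_eq_self g := by
    have h : MeasurePreserving (fun p : (ℝ × ℝ) × ℝ =>
        ((g.x + p.1.1, g.z + p.1.2), g.y + g.x * p.1.2 + p.2)) := by
      have h1 : MeasurePreserving (fun p : ℝ × ℝ => (g.x + p.1, g.z + p.2)) :=
        (measurePreserving_add_left volume g.x).prod (measurePreserving_add_left volume g.z)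
      refine h1.skew_product (g := fun p y => g.y + g.x * p.2 + y) ?_ ?_
      · exact Continuous.measurable (by fun_prop)
      · exact Filter.Eventually.of_forall fun p => map_add_left_eq_self volume _
    exact ((MeasurePreserving.symm _ measurePreserving_entries).comp
      (h.comp measurePreserving_entries)).map_eq

instance : Measure.IsMulRightInvariant (volume : Measure Heis) where
  map_mul_right_eq_self g := by
    have h : MeasurePreserving (fun p : (ℝ × ℝ) × ℝ =>
        ((p.1.1 + g.x, p.1.2 + g.z), p.2 + p.1.1 * g.z + g.y)) := by
      have h1 : MeasurePreserving (fun p : ℝ × ℝ => (p.1 + g.x, p.2 + g.z)) :=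
        (measurePreserving_add_right volume g.x).prod (measurePreserving_add_right volume g.z)
      refine h1.skew_product (g := fun p y => y + p.1 * g.z + g.y) ?_ ?_
      · exact Continuous.measurable (by fun_prop)
      · refine Filter.Eventually.of_forall fun p => ?_
        simpa only [add_assoc] using map_add_right_eq_self (volume : Measure ℝ) (p.1 * g.z + g.y)
    exact ((MeasurePreserving.symm _ measurePreserving_entries).comp
      (h.comp measurePreserving_entries)).map_eq

/-- The lattice of integer matrices. -/
def Γ : Subgroup Heis where
  carrier := {g | (∃ m : ℤ, g.x = m) ∧ (∃ m : ℤ, g.y = m) ∧ ∃ m : ℤ, g.z = m}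
  one_mem' := ⟨⟨0, by simp⟩, ⟨0, by simp⟩, ⟨0, by simp⟩⟩
  mul_mem' := by
    rintro g h ⟨⟨a, ha⟩, ⟨b, hb⟩, ⟨c, hc⟩⟩ ⟨⟨a', ha'⟩, ⟨b', hb'⟩, ⟨c', hc'⟩⟩
    exact ⟨⟨a + a', by simp [ha, ha']⟩, ⟨b + a * c' + b', by simp [hb, ha, hc', hb']⟩,
      ⟨c + c', by simp [hc, hc']⟩⟩
  inv_mem' := by
    rintro g ⟨⟨a, ha⟩, ⟨b, hb⟩, ⟨c, hc⟩⟩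
    exact ⟨⟨-a, by simp [ha]⟩, ⟨a * c - b, by simp [ha, hb, hc]⟩, ⟨-c, by simp [hc]⟩⟩

/-- The Heisenberg nilmanifold `G/Γ`, the space of left cosets `gΓ`. -/
abbrev Nil : Type := Heis ⧸ Γ

/-- The unit cube, a fundamental domain for the right action of `Γ`. -/
def cube : Set Heis :=
  {g | g.x ∈ Set.Ico (0 : ℝ) 1 ∧ g.y ∈ Set.Ico (0 : ℝ) 1 ∧ g.z ∈ Set.Ico (0 : ℝ) 1}

/-- The normalised Haar measure on `G/Γ`: the image of Lebesgue measure on the unit cube.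
See `nilHaar_isProbabilityMeasure` and `nilHaar_smulInvariant`. -/
def nilHaar : Measure Nil :=
  Measure.map (QuotientGroup.mk : Heis → Nil) ((volume : Measure Heis).restrict cube)

theorem exists_unique_int_add (t : ℝ) : ∃! n : ℤ, t + n ∈ Set.Ico (0 : ℝ) 1 := by
  refine ⟨-⌊t⌋, ⟨?_, ?_⟩, ?_⟩
  · push_cast; linarith [Int.floor_le t]
  · push_cast; linarith [Int.lt_floor_add_one t]
  · rintro n ⟨h0, h1⟩
    have : ⌊t⌋ = -n := Int.floor_eq_iff.2 ⟨by push_cast; linarith, by push_cast; linarith⟩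
    omega

theorem isFundamentalDomain_cube : IsFundamentalDomain Γ.op cube (volume : Measure Heis) := by
  refine IsFundamentalDomain.mk' ?_ fun g => ?_
  · refine MeasurableSet.nullMeasurableSet ?_
    exact (continuous_x.measurable measurableSet_Ico).inter
      ((continuous_y.measurable measurableSet_Ico).inter
        (continuous_z.measurable measurableSet_Ico))
  · obtain ⟨m, hm, hm'⟩ := exists_unique_int_add g.x
    obtain ⟨n, hn, hn'⟩ := exists_unique_int_add g.z
    obtain ⟨k, hk, hk'⟩ := exists_unique_int_add (g.y + g.x * n)
    refine ⟨⟨MulOpposite.op ⟨m, k, n⟩, ⟨⟨m, rfl⟩, ⟨k, rfl⟩, ⟨n, rfl⟩⟩⟩, ⟨hm, hk, hn⟩, ?_⟩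
    rintro ⟨γ, ⟨m₁, h₁⟩, ⟨k₁, h₂⟩, ⟨n₁, h₃⟩⟩ ⟨hx, hy, hz⟩
    change (g * γ.unop).x ∈ _ at hx
    change (g * γ.unop).y ∈ _ at hy
    change (g * γ.unop).z ∈ _ at hz
    rw [mul_x, h₁] at hx
    rw [mul_z, h₃] at hz
    rw [mul_y, h₂, h₃] at hy
    obtain rfl := hm' _ hx
    obtain rfl := hn' _ hz
    obtain rfl := hk' _ hy
    apply Subtype.ext
    apply MulOpposite.unop_injective
    ext
    · exact h₁
    · exact h₂
    · exact h₃

instance : Countable Γ.op := by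
  have h : Set.Countable {g : Heis | g ∈ Γ} := by
    refine (Set.countable_range fun p : ℤ × ℤ × ℤ => (⟨p.1, p.2.1, p.2.2⟩ : Heis)).mono ?_
    rintro g ⟨⟨a, ha⟩, ⟨b, hb⟩, ⟨c, hc⟩⟩
    exact ⟨(a, b, c), Heis.ext ha.symm hb.symm hc.symm⟩
  have : Countable Γ := h.to_subtype
  exact Γ.equivOp.symm.injective.countable

theorem isClosed_Γ : IsClosed (Γ : Set Heis) := by
  have h : IsClosed (Set.range ((↑) : ℤ → ℝ)) := Int.isClosedEmbedding_coe_real.isClosed_range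
  have e : (Γ : Set Heis) = Heis.x ⁻¹' Set.range ((↑) : ℤ → ℝ) ∩
      (Heis.y ⁻¹' Set.range ((↑) : ℤ → ℝ) ∩ Heis.z ⁻¹' Set.range ((↑) : ℤ → ℝ)) := by
    ext g
    simp [Γ, eq_comm]
  rw [e]
  exact (h.preimage continuous_x).inter
    ((h.preimage continuous_y).inter (h.preimage continuous_z))

instance : T2Space Nil :=
  have : IsClosed (Γ : Set Heis) := isClosed_Γ
  inferInstance

instance nilHaar_isProbabilityMeasure : IsProbabilityMeasure nilHaar := by
  constructor
  have hm : Measurable (QuotientGroup.mk : Heis → Nil) := measurable_quotient_mk''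
  rw [nilHaar, Measure.map_apply hm MeasurableSet.univ, Set.preimage_univ,
    Measure.restrict_apply_univ]
  have e : cube = entriesHomeo.toMeasurableEquiv ⁻¹'
      ((Set.Ico (0 : ℝ) 1 ×ˢ Set.Ico (0 : ℝ) 1) ×ˢ Set.Ico (0 : ℝ) 1) := by
    ext g
    change (_ ∧ _ ∧ _) ↔ ((_ ∧ _) ∧ _)
    exact ⟨fun h => ⟨⟨h.1, h.2.2⟩, h.2.1⟩, fun h => ⟨h.1.1, h.2, h.1.2⟩⟩
  rw [e, measurePreserving_entries.measure_preimage_equiv]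
  simp [Measure.volume_eq_prod]

instance nilHaar_smulInvariant : SMulInvariantMeasure Heis Nil nilHaar := by
  have : HasFundamentalDomain Γ.op Heis (volume : Measure Heis) := ⟨⟨_, isFundamentalDomain_cube⟩⟩
  have : SMulInvariantMeasure Γ.op Heis (volume : Measure Heis) :=
    ⟨fun c s _ => measure_preimage_mul_right volume c.1.unop s⟩
  have : QuotientMeasureEqMeasurePreimage (volume : Measure Heis) nilHaar :=
    isFundamentalDomain_cube.quotientMeasureEqMeasurePreimage_quotientMeasure
  exact QuotientMeasureEqMeasurePreimage.smulInvariantMeasure_quotient (volume : Measure Heis)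

/-- The Mal'cev coordinate map of the basis `X₁ = E₁₂`, `X₂ = E₂₃`, `X₃ = E₁₃`
(see `toMatrix_eq_exp`). -/
def psi (g : Heis) : Fin 3 → ℝ := ![g.x, g.z, g.y - g.x * g.z]

theorem exp_of_sq_zero (A : Matrix (Fin 3) (Fin 3) ℝ) (h : A * A = 0) :
    NormedSpace.exp A = 1 + A := by
  rw [NormedSpace.exp_eq_tsum ℝ]
  change ∑' n : ℕ, ((n.factorial : ℝ)⁻¹) • A ^ n = 1 + A
  rw [tsum_eq_sum (s := Finset.range 2)]
  · simp [Finset.sum_range_succ]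
  · intro n hn
    have hn' : 2 ≤ n := by simpa [Nat.succ_le_iff] using hn
    obtain ⟨k, rfl⟩ := Nat.exists_eq_add_of_le hn'
    simp [pow_add, pow_two, h]

/-- `g = exp(t₁X₁) exp(t₂X₂) exp(t₃X₃)` with `(t₁, t₂, t₃) = psi g`. -/
theorem toMatrix_eq_exp (g : Heis) :
    g.toMatrix =
      NormedSpace.exp (psi g 0 • (!![0, 1, 0; 0, 0, 0; 0, 0, 0] : Matrix (Fin 3) (Fin 3) ℝ)) *
      NormedSpace.exp (psi g 1 • (!![0, 0, 0; 0, 0, 1; 0, 0, 0] : Matrix (Fin 3) (Fin 3) ℝ)) *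
      NormedSpace.exp (psi g 2 • (!![0, 0, 1; 0, 0, 0; 0, 0, 0] : Matrix (Fin 3) (Fin 3) ℝ)) := by
  rw [exp_of_sq_zero, exp_of_sq_zero, exp_of_sq_zero]
  · ext i j
    fin_cases i <;> fin_cases j <;>
      simp [toMatrix, psi, Matrix.mul_apply, Fin.sum_univ_three, Matrix.one_apply]
  all_goals
    ext i j
    fin_cases i <;> fin_cases j <;> simp [Matrix.mul_apply, Fin.sum_univ_three]

/-- The metric on `G` determined by the Mal'cev basis: the infimum, over all finite chains
`x = c 0, c 1, …, c n = y`, of `∑ min (|ψ(c i * (c (i+1))⁻¹)|, |ψ(c (i+1) * (c i)⁻¹)|)`, where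
`|·|` is the sup norm on `ℝ³`. -/
def heisDist (x y : Heis) : ℝ :=
  sInf {r : ℝ | ∃ (n : ℕ) (c : ℕ → Heis), c 0 = x ∧ c n = y ∧
    r = ∑ i ∈ Finset.range n,
      min ‖psi (c i * (c (i + 1))⁻¹)‖ ‖psi (c (i + 1) * (c i)⁻¹)‖}

/-- The induced metric on `G/Γ`. -/
def nilDist (p q : Nil) : ℝ :=
  sInf {r : ℝ | ∃ x y : Heis, (QuotientGroup.mk x : Nil) = p ∧ (QuotientGroup.mk y : Nil) = q ∧
    r = heisDist x y}

/-- Lipschitz functions on `G/Γ`. -/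
def IsLipschitz (F : Nil → ℂ) : Prop :=
  ∃ K : ℝ, ∀ p q : Nil, ‖F p - F q‖ ≤ K * nilDist p q

/-- The Lipschitz norm `‖F‖_∞ + sup_{p ≠ q} |F p - F q| / d(p, q)`. Both suprema are finite for
Lipschitz `F`, since `G/Γ` has finite diameter. -/
def lipNorm (F : Nil → ℂ) : ℝ :=
  (⨆ p : Nil, ‖F p‖) +
    ⨆ pq : {pq : Nil × Nil // pq.1 ≠ pq.2}, ‖F pq.1.1 - F pq.1.2‖ / nilDist pq.1.1 pq.1.2

/-- The finite sequence `(g(n)Γ)`, `1 ≤ n ≤ N`, is `δ`-equidistributed in `G/Γ`. -/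
def IsEquidistributed (g : ℤ → Heis) (N : ℕ) (δ : ℝ) : Prop :=
  ∀ F : Nil → ℂ, IsLipschitz F →
    ‖(∑ n ∈ Finset.Icc (1 : ℤ) N, F (QuotientGroup.mk (g n))) / (N : ℂ) - ∫ p, F p ∂nilHaar‖
      ≤ δ * lipNorm F

/-- Horizontal characters: continuous homomorphisms `G → ℝ/ℤ` that annihilate `Γ`. -/
structure HorizontalCharacter where
  toFun : Heis → UnitAddCircle
  map_mul' : ∀ g h : Heis, toFun (g * h) = toFun g + toFun h
  continuous_toFun : Continuous toFun
  annihilates : ∀ γ ∈ Γ, toFun γ = 0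

namespace HorizontalCharacter

/-- `k ∈ ℤ³` is the frequency of `η` if `η(g) = k · ψ(g) mod ℤ` for all `g`. -/
def IsFrequency (η : HorizontalCharacter) (k : Fin 3 → ℤ) : Prop :=
  ∀ g : Heis, η.toFun g = ((∑ i, (k i : ℝ) * psi g i : ℝ) : UnitAddCircle)

/-- The modulus `|η| = |k|` (sup norm) of a horizontal character with frequency `k`; the frequency
is unique, see `modulus_eq`. -/
def modulus (η : HorizontalCharacter) : ℝ :=
  sInf {r : ℝ | ∃ k : Fin 3 → ℤ, η.IsFrequency k ∧ r = ‖k‖}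

theorem IsFrequency.unique {η : HorizontalCharacter} {k l : Fin 3 → ℤ}
    (hk : η.IsFrequency k) (hl : η.IsFrequency l) : k = l := by
  have key : ∀ d : ℤ, (∀ t : ℝ, ∃ n : ℤ, (n : ℝ) = d * t) → d = 0 := by
    intro d h
    by_contra hd
    have hd' : (d : ℝ) ≠ 0 := by exact_mod_cast hd
    obtain ⟨n, hn⟩ := h (1 / (2 * d))
    have h2 : (2 * n : ℝ) = 1 := by rw [hn]; field_simp
    have h3 : 2 * n = 1 := by exact_mod_cast h2
    omega
  have main : ∀ g : Heis, ∃ n : ℤ, (n : ℝ) = ∑ i, ((k i - l i : ℤ) : ℝ) * psi g i := by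
    intro g
    have h := (hk g).symm.trans (hl g)
    rw [← sub_eq_zero, ← AddCircle.coe_sub, AddCircle.coe_eq_zero_iff] at h
    obtain ⟨n, hn⟩ := h
    refine ⟨n, ?_⟩
    simp only [zsmul_eq_mul, mul_one] at hn
    rw [hn, ← Finset.sum_sub_distrib]
    exact Finset.sum_congr rfl fun i _ => by push_cast; ring
  funext i
  rw [← sub_eq_zero]
  apply key
  intro t
  fin_cases i
  · simpa [psi, Fin.sum_univ_three] using main ⟨t, 0, 0⟩
  · simpa [psi, Fin.sum_univ_three] using main ⟨0, 0, t⟩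
  · simpa [psi, Fin.sum_univ_three] using main ⟨0, t, 0⟩

theorem modulus_eq {η : HorizontalCharacter} {k : Fin 3 → ℤ} (hk : η.IsFrequency k) :
    η.modulus = ‖k‖ := by
  have : {r : ℝ | ∃ l : Fin 3 → ℤ, η.IsFrequency l ∧ r = ‖l‖} = {‖k‖} := by
    ext r
    constructor
    · rintro ⟨l, hl, rfl⟩
      rw [hk.unique hl]; rfl
    · rintro rfl
      exact ⟨k, hk, rfl⟩
  rw [modulus, this, csInf_singleton]

end HorizontalCharacter

end Heis

end

/-!
A Lipschitz function `F` on `G/Γ` is uniformly close to its Fejér mean along the central circle, a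
bounded combination of functions transforming under the centre by a single frequency `ξ`. For
`ξ = 0` such a function lives on the horizontal torus, and its average along `aⁿΓ` is controlled by
geometric sums with phases `k x + l z`, where `x`, `z` are the horizontal coordinates of `a`. For
`ξ ≠ 0` van der Corput's inequality passes to the correlations `f(h aⁿ Γ) conj (f (aⁿ Γ))`, which
are horizontal functions twisted by a linear phase `n ξ B(h)`, with `B` the bracket form of `x` and
`z`. If `x` and `z` satisfy no small integer relation modulo `1`, then `B(h)` is close to a given
frequency of the torus for few `h` only, so most correlations are small. A small integer relation is
a horizontal character of small modulus that almost annihilates `a`.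
-/

noncomputable section

open scoped FourierTransform

/-! ### Exponential sums and the Fejér kernel -/

theorem coe_fourierChar_add (s t : ℝ) : (𝐞 (s + t) : ℂ) = 𝐞 s * 𝐞 t := by
  rw [AddChar.map_add_eq_mul, Circle.coe_mul]

theorem coe_fourierChar_neg (t : ℝ) : (𝐞 (-t) : ℂ) = star (𝐞 t : ℂ) := by
  rw [AddChar.map_neg_eq_inv, Circle.coe_inv_eq_conj, Complex.star_def]

theorem fourierChar_intCast (n : ℤ) : 𝐞 (n : ℝ) = 1 := by
  rw [Real.fourierChar_apply', mul_comm, Circle.exp_int_mul_two_pi]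

theorem fourierChar_add_intCast (t : ℝ) (n : ℤ) : 𝐞 (t + n) = 𝐞 t := by
  rw [AddChar.map_add_eq_mul, fourierChar_intCast, mul_one]

theorem coe_fourierChar_one_half : (𝐞 (1 / 2) : ℂ) = -1 := by
  rw [Real.fourierChar_apply, ← Complex.exp_pi_mul_I]
  push_cast
  ring_nf

theorem continuous_coe_fourierChar : Continuous fun t : ℝ => (𝐞 t : ℂ) :=
  continuous_subtype_val.comp Real.continuous_fourierChar

theorem coe_natCast_mul_fourierChar (n : ℕ) (t : ℝ) : (𝐞 (n * t) : ℂ) = (𝐞 t : ℂ) ^ n := by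
  rw [← nsmul_eq_mul, AddChar.map_nsmul_eq_pow, Circle.coe_pow]

theorem norm_coe_unitAddCircle_le_abs (t : ℝ) : ‖(t : UnitAddCircle)‖ ≤ |t| := by
  simpa only [UnitAddCircle.norm_eq, Int.cast_zero, sub_zero] using round_le t 0

theorem coe_add_intCast_unitAddCircle (t : ℝ) (n : ℤ) : ((t + n : ℝ) : UnitAddCircle) = t := by
  rw [← sub_eq_zero, ← AddCircle.coe_sub, AddCircle.coe_eq_zero_iff]
  exact ⟨n, by simp⟩

theorem four_mul_norm_le_norm_fourierChar_sub_one (t : ℝ) :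
    4 * ‖(t : UnitAddCircle)‖ ≤ ‖(𝐞 t : ℂ) - 1‖ := by
  rw [UnitAddCircle.norm_eq, ← sub_add_cancel t (round t : ℝ), fourierChar_add_intCast,
    sub_add_cancel]
  have hs := abs_sub_round t
  set s := t - round t
  have hpi := Real.pi_pos
  have hle : |Real.pi * s| ≤ Real.pi / 2 := by
    rw [abs_mul, abs_of_pos hpi]; nlinarith
  have hsin : 2 * |s| ≤ |Real.sin (Real.pi * s)| := by
    have h := Real.mul_abs_le_abs_sin hle
    rwa [abs_mul, abs_of_pos hpi, ← mul_assoc, div_mul_cancel₀ _ hpi.ne'] at h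
  rw [Real.fourierChar_apply, mul_comm _ Complex.I, Complex.norm_exp_I_mul_ofReal_sub_one,
    norm_mul, Real.norm_eq_abs, Real.norm_eq_abs, abs_two, mul_assoc, mul_div_cancel_left₀ _
    (two_ne_zero' ℝ)]
  linarith

theorem norm_sum_range_fourierChar_mul_norm_le (n : ℕ) (t : ℝ) :
    ‖∑ j ∈ Finset.range n, (𝐞 (j * t) : ℂ)‖ * ‖(t : UnitAddCircle)‖ ≤ 1 / 2 := by
  have hgeom : ‖∑ j ∈ Finset.range n, (𝐞 (j * t) : ℂ)‖ * ‖(𝐞 t : ℂ) - 1‖ =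
      ‖(𝐞 (n * t) : ℂ) - 1‖ := by
    simp_rw [coe_natCast_mul_fourierChar, ← norm_mul, geom_sum_mul]
  have htwo : ‖(𝐞 (n * t) : ℂ) - 1‖ ≤ 2 := by
    refine (norm_sub_le _ _).trans_eq ?_
    rw [Circle.norm_coe, norm_one, one_add_one_eq_two]
  have hchord := mul_le_mul_of_nonneg_left (four_mul_norm_le_norm_fourierChar_sub_one t)
    (norm_nonneg (∑ j ∈ Finset.range n, (𝐞 (j * t) : ℂ)))
  linarith

theorem norm_sum_Icc_fourierChar_mul_norm_le (u v : ℤ) (t : ℝ) :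
    ‖∑ n ∈ Finset.Icc u v, (𝐞 (n * t) : ℂ)‖ * ‖(t : UnitAddCircle)‖ ≤ 1 / 2 := by
  have hshift : ∑ n ∈ Finset.Icc u v, (𝐞 (n * t) : ℂ) =
      𝐞 (u * t) * ∑ j ∈ Finset.range (v + 1 - u).toNat, (𝐞 (j * t) : ℂ) := by
    rw [Finset.mul_sum, Int.Icc_eq_finset_map, Finset.sum_map]
    refine Finset.sum_congr rfl fun j _ => ?_
    rw [← coe_fourierChar_add, ← add_mul]
    simp
  rw [hshift, norm_mul, Circle.norm_coe, one_mul]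
  exact norm_sum_range_fourierChar_mul_norm_le _ _

theorem norm_sum_Icc_fourierChar_le {u v : ℤ} {t r : ℝ} (hr : 0 < r)
    (ht : r ≤ ‖(t : UnitAddCircle)‖) :
    ‖∑ n ∈ Finset.Icc u v, (𝐞 (n * t) : ℂ)‖ ≤ 1 / (2 * r) := by
  have h := (mul_le_mul_of_nonneg_left ht (norm_nonneg _)).trans
    (norm_sum_Icc_fourierChar_mul_norm_le u v t)
  rw [le_div_iff₀ (by positivity)]
  linarith

/-- The correlation of the sequence `c 1, …, c N` with its translate by `h`; the summation range
consists of the `n` for which both `n` and `n + h` lie in `[1, N]`. -/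
def autocorrelation (c : ℤ → ℂ) (N : ℕ) (h : ℤ) : ℂ :=
  ∑ n ∈ Finset.Icc (max 1 (1 - h)) (min (N : ℤ) (N - h)), c (n + h) * star (c n)

theorem card_Ioo_neg_le (N : ℕ) : ((Finset.Ioo (-(N : ℤ)) N).card : ℝ) ≤ 2 * N := by
  rw [Int.card_Ioo]
  exact_mod_cast (by omega : ((N : ℤ) - -N - 1).toNat ≤ 2 * N)

theorem card_autocorrelation_range {N : ℕ} {h : ℤ} (hh : |h| ≤ N) :
    ((Finset.Icc (max 1 (1 - h)) (min (N : ℤ) (N - h))).card : ℤ) = N - |h| := by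
  rw [Int.card_Icc]
  rcases abs_cases h with ⟨h₁, h₂⟩ | ⟨h₁, h₂⟩ <;> omega

theorem norm_autocorrelation_le {c : ℤ → ℂ} (hc : ∀ n, ‖c n‖ ≤ 1) {N : ℕ} {h : ℤ}
    (hh : |h| ≤ N) : ‖autocorrelation c N h‖ ≤ N := by
  refine (norm_sum_le_of_le _ (n := fun _ => (1 : ℝ)) fun n _ => ?_).trans ?_
  · rw [norm_mul, norm_star]
    exact mul_le_one₀ (hc _) (norm_nonneg _) (hc _)
  · rw [Finset.sum_const, nsmul_one]
    have hcard := card_autocorrelation_range hh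
    have hpos := abs_nonneg h
    exact_mod_cast (by omega : (Finset.Icc (max 1 (1 - h)) (min (N : ℤ) (N - h))).card ≤ N)

theorem sum_mul_star_sum_eq_sum_autocorrelation (c : ℤ → ℂ) (N : ℕ) :
    (∑ n ∈ Finset.Icc (1 : ℤ) N, c n) * star (∑ n ∈ Finset.Icc (1 : ℤ) N, c n) =
      ∑ h ∈ Finset.Ioo (-(N : ℤ)) N, autocorrelation c N h := by
  rw [star_sum, Finset.sum_mul_sum, ← Finset.sum_product', ← Finset.sum_fiberwise_of_maps_to
    (t := Finset.Ioo (-(N : ℤ)) N) (g := fun p : ℤ × ℤ => p.1 - p.2)]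
  · refine Finset.sum_congr rfl fun h _ => ?_
    refine Finset.sum_nbij' (fun p => p.2) (fun n => (n + h, n)) ?_ ?_ ?_ (fun _ _ => rfl) ?_ <;>
      simp only [Finset.mem_filter, Finset.mem_product, Finset.mem_Icc]
    · rintro ⟨m, n⟩ ⟨hmn, hsub⟩
      omega
    · intro n hn
      omega
    · rintro ⟨m, n⟩ ⟨-, hsub⟩
      rw [Prod.mk.injEq]
      omega
    · rintro ⟨m, n⟩ ⟨-, rfl⟩
      rw [add_sub_cancel]
  · rintro ⟨m, n⟩ hp
    simp only [Finset.mem_product, Finset.mem_Icc, Finset.mem_Ioo] at hp ⊢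
    omega

theorem norm_sum_sq_le_of_norm_autocorrelation_le {c : ℤ → ℂ} (hc : ∀ n, ‖c n‖ ≤ 1) {N : ℕ}
    {bad : Finset ℤ} {E : ℝ} (hE : 0 ≤ E)
    (hgood : ∀ h ∈ Finset.Ioo (-(N : ℤ)) N, h ∉ bad → ‖autocorrelation c N h‖ ≤ E) :
    ‖∑ n ∈ Finset.Icc (1 : ℤ) N, c n‖ ^ 2 ≤ 2 * N * E + bad.card * N := by
  have hsq : ‖∑ n ∈ Finset.Icc (1 : ℤ) N, c n‖ ^ 2 =
      ‖∑ h ∈ Finset.Ioo (-(N : ℤ)) N, autocorrelation c N h‖ := by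
    rw [← sum_mul_star_sum_eq_sum_autocorrelation, norm_mul, norm_star, sq]
  rw [hsq]
  calc ‖∑ h ∈ Finset.Ioo (-(N : ℤ)) N, autocorrelation c N h‖
      ≤ ∑ h ∈ Finset.Ioo (-(N : ℤ)) N, (E + if h ∈ bad then (N : ℝ) else 0) := by
        refine norm_sum_le_of_le _ fun h hh => ?_
        split_ifs with hb
        · have habs : |h| ≤ N := (abs_lt.2 (Finset.mem_Ioo.1 hh)).le
          linarith [norm_autocorrelation_le hc habs]
        · simpa using hgood h hh hb
    _ = (Finset.Ioo (-(N : ℤ)) N).card * E +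
          ({h ∈ Finset.Ioo (-(N : ℤ)) N | h ∈ bad}.card : ℝ) * N := by
        rw [Finset.sum_add_distrib, ← Finset.sum_filter, Finset.sum_const, Finset.sum_const,
          nsmul_eq_mul, nsmul_eq_mul]
    _ ≤ 2 * N * E + bad.card * N := by
        have hcard : {h ∈ Finset.Ioo (-(N : ℤ)) N | h ∈ bad}.card ≤ bad.card :=
          Finset.card_le_card fun h hh => (Finset.mem_filter.1 hh).2
        have := card_Ioo_neg_le N
        gcongr

/-- The Fejér kernel of order `M` on the circle. -/
def fejerKernel (M : ℕ) (t : ℝ) : ℝ := ‖∑ n ∈ Finset.Icc (1 : ℤ) M, (𝐞 (n * t) : ℂ)‖ ^ 2 / M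

/-- The `k`-th Fourier coefficient of the Fejér kernel of order `M`, meaningful for `|k| < M`. -/
def fejerCoeff (M : ℕ) (k : ℤ) : ℝ := 1 - |(k : ℝ)| / M

theorem fejerKernel_nonneg (M : ℕ) (t : ℝ) : 0 ≤ fejerKernel M t := by
  unfold fejerKernel; positivity

theorem continuous_fejerKernel (M : ℕ) : Continuous (fejerKernel M) := by
  have := continuous_coe_fourierChar
  unfold fejerKernel; fun_prop

theorem fejerCoeff_zero (M : ℕ) : fejerCoeff M 0 = 1 := by simp [fejerCoeff]

theorem norm_fejerCoeff_le_one {M : ℕ} {k : ℤ} (hk : k ∈ Finset.Ioo (-(M : ℤ)) M) :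
    ‖(fejerCoeff M k : ℂ)‖ ≤ 1 := by
  have hkM : |(k : ℝ)| ≤ M := by exact_mod_cast (abs_lt.2 (Finset.mem_Ioo.1 hk)).le
  have hle := div_le_one_of_le₀ hkM (Nat.cast_nonneg M)
  rw [Complex.norm_real, Real.norm_eq_abs, fejerCoeff, abs_of_nonneg (sub_nonneg.2 hle)]
  exact sub_le_self _ (by positivity)

theorem autocorrelation_fourierChar {M : ℕ} {k : ℤ} (hk : |k| ≤ M) (t : ℝ) :
    autocorrelation (fun n => 𝐞 (n * t)) M k = (M - |(k : ℝ)| : ℝ) * 𝐞 (k * t) := by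
  have hconst : ∀ n : ℤ, (𝐞 ((n + k : ℤ) * t) : ℂ) * star (𝐞 (n * t) : ℂ) = 𝐞 (k * t) := by
    intro n
    rw [← coe_fourierChar_neg, ← coe_fourierChar_add]
    push_cast
    ring_nf
  have hcard : ((Finset.Icc (max 1 (1 - k)) (min (M : ℤ) (M - k))).card : ℝ) = M - |(k : ℝ)| := by
    exact_mod_cast congrArg (Int.cast : ℤ → ℝ) (card_autocorrelation_range hk)
  simp only [autocorrelation, hconst]
  rw [Finset.sum_const, nsmul_eq_mul, ← hcard, Complex.ofReal_natCast]

theorem fejerKernel_eq_sum {M : ℕ} (hM : 0 < M) (t : ℝ) : (fejerKernel M t : ℂ) =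
    ∑ k ∈ Finset.Ioo (-(M : ℤ)) M, (fejerCoeff M k : ℂ) * 𝐞 (k * t) := by
  have hM' : (M : ℂ) ≠ 0 := by exact_mod_cast hM.ne'
  rw [fejerKernel, Complex.ofReal_div, Complex.ofReal_pow, ← Complex.mul_conj', ← Complex.star_def,
    sum_mul_star_sum_eq_sum_autocorrelation, Finset.sum_div]
  refine Finset.sum_congr rfl fun k hk => ?_
  rw [autocorrelation_fourierChar (abs_lt.2 (Finset.mem_Ioo.1 hk)).le, fejerCoeff]
  push_cast
  field_simp

theorem fejerKernel_eq_sum_neg {M : ℕ} (hM : 0 < M) (t : ℝ) : (fejerKernel M t : ℂ) =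
    ∑ k ∈ Finset.Ioo (-(M : ℤ)) M, (fejerCoeff M k : ℂ) * 𝐞 (-(k * t)) := by
  rw [← Complex.conj_ofReal, fejerKernel_eq_sum hM, map_sum]
  refine Finset.sum_congr rfl fun k _ => ?_
  rw [map_mul, Complex.conj_ofReal, coe_fourierChar_neg, Complex.star_def]

theorem integral_fourierChar_intCast_mul {k : ℤ} (hk : k ≠ 0) :
    ∫ c in (0 : ℝ)..1, (𝐞 (k * c) : ℂ) = 0 := by
  have hk' : (2 * Real.pi * k * Complex.I : ℂ) ≠ 0 := by
    simp [Real.pi_ne_zero, hk]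
  have hexp : ∀ c : ℝ, (𝐞 (k * c) : ℂ) = Complex.exp (2 * Real.pi * k * Complex.I * c) := by
    intro c
    rw [Real.fourierChar_apply]
    push_cast
    ring_nf
  simp_rw [hexp]
  rw [integral_exp_mul_complex hk', ← hexp, ← hexp]
  simp [fourierChar_intCast]

theorem integral_fejerKernel {M : ℕ} (hM : 0 < M) : ∫ c in (0 : ℝ)..1, fejerKernel M c = 1 := by
  have hcont : ∀ k : ℤ, Continuous fun c : ℝ => (fejerCoeff M k : ℂ) * 𝐞 (k * c) := fun k =>
    continuous_const.mul (continuous_coe_fourierChar.comp (continuous_const_mul _))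
  rw [← Complex.ofReal_inj, ← intervalIntegral.integral_ofReal]
  simp_rw [fejerKernel_eq_sum hM]
  rw [intervalIntegral.integral_finsetSum fun k _ => (hcont k).intervalIntegrable _ _,
    Finset.sum_eq_single 0]
  · simp [fejerCoeff_zero]
  · intro k _ hk
    rw [intervalIntegral.integral_const_mul, integral_fourierChar_intCast_mul hk, mul_zero]
  · intro h
    exact absurd (Finset.mem_Ioo.2 (by omega)) h

theorem fejerKernel_mul_norm_le {M : ℕ} (hM : 0 < M) (t : ℝ) :
    fejerKernel M t * ‖(t : UnitAddCircle)‖ ≤ (fejerKernel M t + 1) / (2 * √M) := by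
  have : (0 : ℝ) < √M := Real.sqrt_pos.2 (by exact_mod_cast hM)
  have hsqrt : √(M : ℝ) ^ 2 = M := Real.sq_sqrt (by positivity)
  have hsum := norm_sum_Icc_fourierChar_mul_norm_le 1 M t
  have hdef : fejerKernel M t * √M ^ 2 = ‖∑ n ∈ Finset.Icc (1 : ℤ) M, (𝐞 (n * t) : ℂ)‖ ^ 2 := by
    rw [hsqrt, fejerKernel, div_mul_cancel₀ _ (by positivity)]
  have hf := fejerKernel_nonneg M t
  set f := fejerKernel M t
  set s := ‖(t : UnitAddCircle)‖
  set D := ‖∑ n ∈ Finset.Icc (1 : ℤ) M, (𝐞 (n * t) : ℂ)‖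
  have hquad : f * (√M * s) ^ 2 ≤ 1 / 4 := by
    calc f * (√M * s) ^ 2 = (D * s) ^ 2 := by rw [mul_pow, mul_pow, ← hdef]; ring
      _ ≤ (1 / 2) ^ 2 := pow_le_pow_left₀ (by positivity) hsum 2
      _ = 1 / 4 := by norm_num
  have hamgm : 4 * (f * (√M * s)) ≤ f + 4 * (f * (√M * s) ^ 2) := by
    linarith [mul_nonneg hf (sq_nonneg (2 * (√M * s) - 1))]
  rw [le_div_iff₀ (by positivity)]
  linarith

theorem one_half_le_re_fourierChar {t : ℝ} (ht : |t| ≤ 1 / 8) : 1 / 2 ≤ (𝐞 t : ℂ).re := by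
  rw [Real.fourierChar_apply, Complex.exp_ofReal_mul_I_re]
  have hcos := Real.one_sub_sq_div_two_le_cos (x := 2 * Real.pi * t)
  have hsq : (2 * Real.pi * t) ^ 2 ≤ 1 := by
    rw [sq_le_one_iff_abs_le_one, abs_mul, abs_of_pos (by positivity)]
    nlinarith [Real.pi_lt_d2, Real.pi_pos]
  linarith

theorem div_four_le_fejerKernel {K : ℕ} (hK : 0 < K) {t : ℝ}
    (ht : ‖(t : UnitAddCircle)‖ ≤ 1 / (8 * K)) : (K : ℝ) / 4 ≤ fejerKernel K t := by
  have hK' : (0 : ℝ) < K := by exact_mod_cast hK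
  have hre : ∀ n ∈ Finset.Icc (1 : ℤ) K, (1 / 2 : ℝ) ≤ (𝐞 (n * t) : ℂ).re := by
    intro n hn
    obtain ⟨h1, hnK⟩ := Finset.mem_Icc.1 hn
    have habs : |(n : ℝ)| ≤ K := by
      rw [abs_of_nonneg (by exact_mod_cast (by omega : (0 : ℤ) ≤ n))]
      exact_mod_cast hnK
    have hred : (n : ℝ) * t = n * (t - round t) + ((n * round t : ℤ) : ℝ) := by push_cast; ring
    rw [hred, fourierChar_add_intCast]
    apply one_half_le_re_fourierChar
    rw [UnitAddCircle.norm_eq] at ht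
    rw [abs_mul]
    calc |(n : ℝ)| * |t - round t| ≤ K * (1 / (8 * K)) := by gcongr
      _ = 1 / 8 := by field_simp
  have hsum : (K : ℝ) / 2 ≤ ‖∑ n ∈ Finset.Icc (1 : ℤ) K, (𝐞 (n * t) : ℂ)‖ := by
    refine le_trans ?_ (Complex.re_le_norm _)
    rw [Complex.re_sum]
    refine le_trans (le_of_eq ?_) (Finset.card_nsmul_le_sum _ _ _ hre)
    simp only [Int.card_Icc, add_sub_cancel_right, Int.toNat_natCast, one_div, nsmul_eq_mul]
    ring
  rw [fejerKernel, le_div_iff₀ hK']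
  nlinarith

/-! ### Fejér means of Lipschitz functions on the circle -/

/-- Functions on `ℝ` that are Lipschitz for the distance to the nearest integer; in particular
they are `1`-periodic. -/
def CircleLipschitz (L : ℝ) (φ : ℝ → ℂ) : Prop :=
  ∀ s t : ℝ, ‖φ s - φ t‖ ≤ L * ‖((s - t : ℝ) : UnitAddCircle)‖

/-- The `k`-th Fourier coefficient of a `1`-periodic function on `ℝ`. -/
def circleFourierCoeff (φ : ℝ → ℂ) (k : ℤ) : ℂ := ∫ c in (0 : ℝ)..1, φ c * 𝐞 (-(k * c))

/-- The average of `φ` around `t` against the Fejér kernel of order `M`. -/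
def fejerMean (M : ℕ) (φ : ℝ → ℂ) (t : ℝ) : ℂ := ∫ c in (0 : ℝ)..1, φ (t + c) * fejerKernel M c

section

variable {L : ℝ} {φ ψ : ℝ → ℂ}

theorem CircleLipschitz.nonneg (hφ : CircleLipschitz L φ) : 0 ≤ L := by
  have hhalf : ‖((1 / 2 - 0 : ℝ) : UnitAddCircle)‖ = 1 / 2 := by
    simpa using AddCircle.norm_half_period_eq (1 : ℝ)
  have h := (norm_nonneg _).trans (hφ (1 / 2) 0)
  rw [hhalf] at h
  linarith

theorem CircleLipschitz.periodic (hφ : CircleLipschitz L φ) : Function.Periodic φ 1 := by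
  intro t
  have h := hφ (t + 1) t
  rw [add_sub_cancel_left, AddCircle.coe_period, norm_zero, mul_zero] at h
  exact sub_eq_zero.1 (norm_le_zero_iff.1 h)

theorem CircleLipschitz.continuous (hφ : CircleLipschitz L φ) : Continuous φ := by
  refine LipschitzWith.continuous (K := L.toNNReal) (LipschitzWith.of_dist_le_mul fun s t => ?_)
  rw [dist_eq_norm, Real.dist_eq, Real.coe_toNNReal _ hφ.nonneg]
  exact (hφ s t).trans (mul_le_mul_of_nonneg_left (norm_coe_unitAddCircle_le_abs _) hφ.nonneg)

theorem continuous_mul_fourierChar (hφ : Continuous φ) (k : ℤ) :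
    Continuous fun c : ℝ => φ c * 𝐞 (-(k * c)) :=
  hφ.mul (continuous_coe_fourierChar.comp (by fun_prop))

theorem circleFourierCoeff_sub (hφ : Continuous φ) (hψ : Continuous ψ) (k : ℤ) :
    circleFourierCoeff (fun c => φ c - ψ c) k =
      circleFourierCoeff φ k - circleFourierCoeff ψ k := by
  simp_rw [circleFourierCoeff, sub_mul]
  exact intervalIntegral.integral_sub
    ((continuous_mul_fourierChar hφ k).intervalIntegrable _ _)
    ((continuous_mul_fourierChar hψ k).intervalIntegrable _ _)

theorem circleFourierCoeff_sum_mul {ι : Type*} (s : Finset ι) (a : ι → ℂ) {f : ι → ℝ → ℂ}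
    (hf : ∀ i ∈ s, Continuous (f i)) (k : ℤ) :
    circleFourierCoeff (fun c => ∑ i ∈ s, a i * f i c) k =
      ∑ i ∈ s, a i * circleFourierCoeff (f i) k := by
  have hint : ∀ i ∈ s, IntervalIntegrable (fun c : ℝ => a i * (f i c * 𝐞 (-(k * c)))) volume 0 1 :=
    fun i hi =>
      (continuous_const.mul (continuous_mul_fourierChar (hf i hi) k)).intervalIntegrable _ _
  simp_rw [circleFourierCoeff, Finset.sum_mul, mul_assoc]
  rw [intervalIntegral.integral_finsetSum hint]
  simp_rw [intervalIntegral.integral_const_mul]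

theorem norm_circleFourierCoeff_le {B : ℝ} (hB : ∀ c, ‖φ c‖ ≤ B) (k : ℤ) :
    ‖circleFourierCoeff φ k‖ ≤ B := by
  have h : ∀ c : ℝ, ‖φ c * 𝐞 (-(k * c))‖ ≤ B := fun c => by
    rw [norm_mul, Circle.norm_coe, mul_one]
    exact hB c
  simpa [circleFourierCoeff] using
    intervalIntegral.norm_integral_le_of_norm_le_const (a := 0) (b := 1) fun c _ => h c

theorem circleFourierCoeff_comp_add (hφ : Function.Periodic φ 1) (k : ℤ) (d : ℝ) :
    circleFourierCoeff (fun c => φ (d + c)) k = 𝐞 (k * d) * circleFourierCoeff φ k := by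
  set f : ℝ → ℂ := fun c => φ c * 𝐞 (-(k * c)) with hf
  have hper : Function.Periodic f 1 := by
    intro c
    have hexp : -(k * (c + 1) : ℝ) = -(k * c) + ((-k : ℤ) : ℝ) := by push_cast; ring
    simp only [hf]
    rw [hφ, hexp, fourierChar_add_intCast]
  have hshift : ∀ c, φ (d + c) * 𝐞 (-(k * c)) = 𝐞 (k * d) * f (d + c) := by
    intro c
    simp only [hf]
    rw [mul_left_comm, ← coe_fourierChar_add]
    ring_nf
  simp_rw [circleFourierCoeff, hshift]
  rw [intervalIntegral.integral_const_mul, intervalIntegral.integral_comp_add_left f, add_zero,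
    hper.intervalIntegral_add_eq d 0, zero_add]

theorem fejerMean_eq_sum (hφ : Continuous φ) (hper : Function.Periodic φ 1) {M : ℕ} (hM : 0 < M)
    (t : ℝ) : fejerMean M φ t = ∑ k ∈ Finset.Ioo (-(M : ℤ)) M,
      fejerCoeff M k * circleFourierCoeff φ k * 𝐞 (k * t) := by
  have hint : ∀ k ∈ Finset.Ioo (-(M : ℤ)) M, IntervalIntegrable
      (fun c : ℝ => fejerCoeff M k * (φ (t + c) * 𝐞 (-(k * c)))) volume 0 1 := fun k _ =>
    (continuous_const.mul (continuous_mul_fourierChar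
      (hφ.comp (continuous_const_add t)) k)).intervalIntegrable _ _
  simp_rw [fejerMean, fejerKernel_eq_sum_neg hM, Finset.mul_sum, mul_left_comm (φ _)]
  rw [intervalIntegral.integral_finsetSum hint]
  refine Finset.sum_congr rfl fun k _ => ?_
  rw [intervalIntegral.integral_const_mul, mul_assoc, mul_comm (circleFourierCoeff φ k),
    ← circleFourierCoeff_comp_add hper, circleFourierCoeff]

theorem continuous_mul_fejerKernel (hφ : Continuous φ) (M : ℕ) (t : ℝ) :
    Continuous fun c : ℝ => φ (t + c) * fejerKernel M c :=
  (hφ.comp (continuous_const_add t)).mul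
    (Complex.continuous_ofReal.comp (continuous_fejerKernel M))

theorem norm_mul_fejerKernel (z : ℂ) (M : ℕ) (c : ℝ) :
    ‖z * fejerKernel M c‖ = ‖z‖ * fejerKernel M c := by
  rw [norm_mul, Complex.norm_real, Real.norm_of_nonneg (fejerKernel_nonneg M c)]

theorem norm_fejerMean_sub_le (hφ : Continuous φ) (hψ : Continuous ψ) {r : ℝ}
    (hr : ∀ s, ‖φ s - ψ s‖ ≤ r) {M : ℕ} (hM : 0 < M) (t : ℝ) :
    ‖fejerMean M φ t - fejerMean M ψ t‖ ≤ r := by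
  rw [fejerMean, fejerMean, ← intervalIntegral.integral_sub
    ((continuous_mul_fejerKernel hφ M t).intervalIntegrable _ _)
    ((continuous_mul_fejerKernel hψ M t).intervalIntegrable _ _)]
  calc _ ≤ ∫ c in (0 : ℝ)..1, r * fejerKernel M c := by
        refine intervalIntegral.norm_integral_le_of_norm_le zero_le_one
          (Filter.Eventually.of_forall fun c _ => ?_)
          ((continuous_const.mul (continuous_fejerKernel M)).intervalIntegrable _ _)
        rw [← sub_mul, norm_mul_fejerKernel]
        exact mul_le_mul_of_nonneg_right (hr _) (fejerKernel_nonneg M c)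
    _ = r := by rw [intervalIntegral.integral_const_mul, integral_fejerKernel hM, mul_one]

theorem CircleLipschitz.norm_sub_fejerMean_le (hφ : CircleLipschitz L φ) {M : ℕ} (hM : 0 < M)
    (t : ℝ) : ‖φ t - fejerMean M φ t‖ ≤ L / √M := by
  have hkernel := continuous_fejerKernel M
  have hconst : φ t = ∫ c in (0 : ℝ)..1, φ t * fejerKernel M c := by
    rw [intervalIntegral.integral_const_mul, intervalIntegral.integral_ofReal,
      integral_fejerKernel hM, Complex.ofReal_one, mul_one]
  have hint : IntervalIntegrable (fun c : ℝ => φ t * fejerKernel M c) volume 0 1 :=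
    (continuous_mul_fejerKernel (φ := fun _ => φ t) continuous_const M t).intervalIntegrable _ _
  have hbound : ∀ c : ℝ, ‖φ t * fejerKernel M c - φ (t + c) * fejerKernel M c‖ ≤
      L * ((fejerKernel M c + 1) / (2 * √M)) := by
    intro c
    have hlip := hφ (t + c) t
    rw [add_sub_cancel_left, norm_sub_rev] at hlip
    rw [← sub_mul, norm_mul_fejerKernel]
    calc ‖φ t - φ (t + c)‖ * fejerKernel M c
        ≤ L * ‖(c : UnitAddCircle)‖ * fejerKernel M c :=
          mul_le_mul_of_nonneg_right hlip (fejerKernel_nonneg M c)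
      _ = L * (fejerKernel M c * ‖(c : UnitAddCircle)‖) := by ring
      _ ≤ _ := mul_le_mul_of_nonneg_left (fejerKernel_mul_norm_le hM c) hφ.nonneg
  nth_rewrite 1 [hconst]
  rw [fejerMean, ← intervalIntegral.integral_sub hint
    ((continuous_mul_fejerKernel hφ.continuous M t).intervalIntegrable _ _)]
  refine (intervalIntegral.norm_integral_le_of_norm_le zero_le_one
    (Filter.Eventually.of_forall fun c _ => hbound c)
    (Continuous.intervalIntegrable (by fun_prop) _ _)).trans_eq ?_
  rw [intervalIntegral.integral_const_mul, intervalIntegral.integral_div,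
    intervalIntegral.integral_add (hkernel.intervalIntegrable _ _)
      (continuous_const.intervalIntegrable _ _), integral_fejerKernel hM]
  simp only [intervalIntegral.integral_const, sub_zero, one_smul]
  ring

end

section

variable {L : ℝ} {φ : ℝ → ℝ → ℂ}

theorem CircleLipschitz.circleFourierCoeff (h₁ : ∀ t, CircleLipschitz L fun s => φ s t)
    (h₂ : ∀ s, Continuous (φ s)) (l : ℤ) :
    CircleLipschitz L fun s => circleFourierCoeff (φ s) l := by
  intro s s'
  rw [← circleFourierCoeff_sub (h₂ s) (h₂ s')]
  exact norm_circleFourierCoeff_le (fun t => h₁ t s s') l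

theorem CircleLipschitz.fejerMean (h₁ : ∀ t, CircleLipschitz L fun s => φ s t)
    (h₂ : ∀ s, Continuous (φ s)) {M : ℕ} (hM : 0 < M) (t : ℝ) :
    CircleLipschitz L fun s => fejerMean M (φ s) t :=
  fun s s' => norm_fejerMean_sub_le (h₂ s) (h₂ s') (fun t => h₁ t s s') hM t

/-- The coefficients of the bivariate Fejér mean of order `M` of a function on the torus. -/
def torusFejerCoeff (M : ℕ) (φ : ℝ → ℝ → ℂ) (k l : ℤ) : ℂ :=
  fejerCoeff M k * (fejerCoeff M l * circleFourierCoeff (fun s => circleFourierCoeff (φ s) l) k)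

theorem norm_torusFejerCoeff_le {B : ℝ} (hB : ∀ s t, ‖φ s t‖ ≤ B) {M : ℕ} {k l : ℤ}
    (hk : k ∈ Finset.Ioo (-(M : ℤ)) M) (hl : l ∈ Finset.Ioo (-(M : ℤ)) M) :
    ‖torusFejerCoeff M φ k l‖ ≤ B := by
  have hcoeff : ‖circleFourierCoeff (fun s => circleFourierCoeff (φ s) l) k‖ ≤ B :=
    norm_circleFourierCoeff_le (fun s => norm_circleFourierCoeff_le (hB s) l) k
  rw [torusFejerCoeff, norm_mul, norm_mul]
  refine (mul_le_of_le_one_left (by positivity) (norm_fejerCoeff_le_one hk)).trans ?_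
  exact (mul_le_of_le_one_left (norm_nonneg _) (norm_fejerCoeff_le_one hl)).trans hcoeff

theorem norm_sub_sum_torusFejerCoeff_le (h₁ : ∀ t, CircleLipschitz L fun s => φ s t)
    (h₂ : ∀ s, CircleLipschitz L (φ s)) {M : ℕ} (hM : 0 < M) (s t : ℝ) :
    ‖φ s t - ∑ k ∈ Finset.Ioo (-(M : ℤ)) M, ∑ l ∈ Finset.Ioo (-(M : ℤ)) M,
      torusFejerCoeff M φ k l * 𝐞 (k * s + l * t)‖ ≤ 2 * L / √M := by
  set G : ℝ → ℂ := fun s => fejerMean M (φ s) t with hG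
  have hcont : ∀ s, Continuous (φ s) := fun s => (h₂ s).continuous
  have hGlip : CircleLipschitz L G := CircleLipschitz.fejerMean h₁ hcont hM t
  have hGsum : G = fun s => ∑ l ∈ Finset.Ioo (-(M : ℤ)) M,
      (fejerCoeff M l * 𝐞 (l * t) : ℂ) * circleFourierCoeff (φ s) l := by
    funext s
    rw [hG]
    simp only [fejerMean_eq_sum (hcont s) (h₂ s).periodic hM, mul_right_comm]
  have hcoeff : ∀ k, circleFourierCoeff G k = ∑ l ∈ Finset.Ioo (-(M : ℤ)) M,
      (fejerCoeff M l * 𝐞 (l * t) : ℂ) *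
        circleFourierCoeff (fun s => circleFourierCoeff (φ s) l) k := by
    intro k
    rw [hGsum]
    exact circleFourierCoeff_sum_mul _ _
      (fun l _ => (CircleLipschitz.circleFourierCoeff h₁ hcont l).continuous) k
  have hmean : fejerMean M G s = ∑ k ∈ Finset.Ioo (-(M : ℤ)) M, ∑ l ∈ Finset.Ioo (-(M : ℤ)) M,
      torusFejerCoeff M φ k l * 𝐞 (k * s + l * t) := by
    rw [fejerMean_eq_sum hGlip.continuous hGlip.periodic hM]
    refine Finset.sum_congr rfl fun k _ => ?_
    rw [hcoeff, Finset.mul_sum, Finset.sum_mul]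
    refine Finset.sum_congr rfl fun l _ => ?_
    rw [torusFejerCoeff, coe_fourierChar_add]
    ring
  rw [← hmean]
  calc ‖φ s t - fejerMean M G s‖ ≤ ‖φ s t - G s‖ + ‖G s - fejerMean M G s‖ :=
        norm_sub_le_norm_sub_add_norm_sub _ _ _
    _ ≤ L / √M + L / √M :=
        add_le_add ((h₂ s).norm_sub_fejerMean_le hM t) (hGlip.norm_sub_fejerMean_le hM s)
    _ = 2 * L / √M := by ring

end

/-! ### Integer relations and bracket forms -/

theorem sum_fejerKernel_le {K : ℕ} (hK : 0 < K) {x r : ℝ} (hr : 0 < r)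
    (hx : ∀ k : ℤ, k ≠ 0 → |k| < K → r ≤ ‖((k * x : ℝ) : UnitAddCircle)‖) (u v : ℤ) (β : ℝ) :
    ∑ h ∈ Finset.Icc u v, fejerKernel K (h * x - β) ≤ (Finset.Icc u v).card + K / r := by
  have hexpand : ((∑ h ∈ Finset.Icc u v, fejerKernel K (h * x - β) : ℝ) : ℂ) =
      ∑ k ∈ Finset.Ioo (-(K : ℤ)) K, fejerCoeff K k * (𝐞 (-(k * β)) : ℂ) *
        ∑ h ∈ Finset.Icc u v, (𝐞 (h * (k * x)) : ℂ) := by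
    simp_rw [Complex.ofReal_sum, fejerKernel_eq_sum hK, Finset.mul_sum]
    rw [Finset.sum_comm]
    refine Finset.sum_congr rfl fun k _ => Finset.sum_congr rfl fun h _ => ?_
    rw [mul_assoc, ← coe_fourierChar_add]
    ring_nf
  have hterm : ∀ k ∈ Finset.Ioo (-(K : ℤ)) K, ‖fejerCoeff K k * (𝐞 (-(k * β)) : ℂ) *
      ∑ h ∈ Finset.Icc u v, (𝐞 (h * (k * x)) : ℂ)‖ ≤
        (if k = 0 then ((Finset.Icc u v).card : ℝ) else 0) + 1 / (2 * r) := by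
    intro k hk
    rw [norm_mul, norm_mul, Circle.norm_coe, mul_one]
    refine (mul_le_of_le_one_left (norm_nonneg _) (norm_fejerCoeff_le_one hk)).trans ?_
    split_ifs with h0
    · simp [h0, hr.le]
    · rw [zero_add]
      exact norm_sum_Icc_fourierChar_le hr (hx k h0 (abs_lt.2 (Finset.mem_Ioo.1 hk)))
  calc ∑ h ∈ Finset.Icc u v, fejerKernel K (h * x - β)
      = ‖((∑ h ∈ Finset.Icc u v, fejerKernel K (h * x - β) : ℝ) : ℂ)‖ := by
        rw [Complex.norm_real, Real.norm_of_nonneg]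
        exact Finset.sum_nonneg fun _ _ => fejerKernel_nonneg _ _
    _ ≤ ∑ k ∈ Finset.Ioo (-(K : ℤ)) K,
          ((if k = 0 then ((Finset.Icc u v).card : ℝ) else 0) + 1 / (2 * r)) := by
        rw [hexpand]
        exact norm_sum_le_of_le _ hterm
    _ = (Finset.Icc u v).card + (Finset.Ioo (-(K : ℤ)) K).card * (1 / (2 * r)) := by
        rw [Finset.sum_add_distrib, Finset.sum_ite_eq', if_pos (Finset.mem_Ioo.2 (by omega)),
          Finset.sum_const, nsmul_eq_mul]
    _ ≤ (Finset.Icc u v).card + 2 * K * (1 / (2 * r)) := by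
        have := card_Ioo_neg_le K
        gcongr
    _ = (Finset.Icc u v).card + K / r := by field_simp

theorem card_le_of_norm_mul_sub_le {K : ℕ} (hK : 0 < K) {x β r : ℝ} (hr : 0 < r)
    (hx : ∀ k : ℤ, k ≠ 0 → |k| < K → r ≤ ‖((k * x : ℝ) : UnitAddCircle)‖) {u v : ℤ}
    {S : Finset ℤ} (hS : S ⊆ Finset.Icc u v)
    (hβ : ∀ h ∈ S, ‖((h * x - β : ℝ) : UnitAddCircle)‖ ≤ 1 / (8 * K)) :
    (S.card : ℝ) ≤ 4 * (Finset.Icc u v).card / K + 4 / r := by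
  have : (0 : ℝ) < K := by exact_mod_cast hK
  have hlower : S.card * ((K : ℝ) / 4) ≤ ∑ h ∈ Finset.Icc u v, fejerKernel K (h * x - β) := by
    rw [← nsmul_eq_mul]
    exact (Finset.card_nsmul_le_sum _ _ _ fun h hh => div_four_le_fejerKernel hK (hβ h hh)).trans
      (Finset.sum_le_sum_of_subset_of_nonneg hS fun _ _ _ => fejerKernel_nonneg _ _)
  have h := hlower.trans (sum_fejerKernel_le hK hr hx u v β)
  calc (S.card : ℝ) = S.card * ((K : ℝ) / 4) * (4 / K) := by field_simp
    _ ≤ ((Finset.Icc u v).card + K / r) * (4 / K) := by gcongr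
    _ = 4 * (Finset.Icc u v).card / K + 4 / r := by field_simp

/-- No nonzero integer combination of `x` and `z` with coefficients bounded by `Q` comes within `r`
of an integer. -/
def NoIntegerRelation (x z Q r : ℝ) : Prop :=
  ∀ k l : ℤ, k ≠ 0 ∨ l ≠ 0 → |(k : ℝ)| ≤ Q → |(l : ℝ)| ≤ Q →
    r < ‖((k * x + l * z : ℝ) : UnitAddCircle)‖

theorem NoIntegerRelation.lt_norm_mul_left {x z Q r : ℝ} (hrel : NoIntegerRelation x z Q r)
    {k : ℤ} (hk : k ≠ 0) (hkQ : |(k : ℝ)| ≤ Q) : r < ‖((k * x : ℝ) : UnitAddCircle)‖ := by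
  simpa using hrel k 0 (Or.inl hk) hkQ (by simpa using (abs_nonneg _).trans hkQ)

theorem NoIntegerRelation.lt_one_half {x z Q r : ℝ} (hrel : NoIntegerRelation x z Q r)
    (hQ : 1 ≤ Q) : r < 1 / 2 := by
  refine (hrel.lt_norm_mul_left one_ne_zero (by simpa using hQ)).trans_le ?_
  simpa using AddCircle.norm_le_half_period (1 : ℝ) one_ne_zero

/-- The bracket form `x {k z} - z {k x}`. If `a` has horizontal coordinates `x`, `z`, then commuting
`a ^ n` past the representative of `a ^ k Γ` with horizontal coordinates in `[0, 1)` costs a central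
element whose entry is `n` times this number. -/
def bracketForm (x z : ℝ) (k : ℤ) : ℝ := x * Int.fract (k * z) - z * Int.fract (k * x)

/-- The integer by which the additive relation `h - h' = t (h₁ - h₂)` fails to be respected by
`k ↦ ⌊k w⌋`. -/
def carry (h h' h₁ h₂ t : ℤ) (w : ℝ) : ℤ := ⌊h * w⌋ - ⌊h' * w⌋ - t * (⌊h₁ * w⌋ - ⌊h₂ * w⌋)

theorem abs_fract_sub_fract_lt_one (s t : ℝ) : |Int.fract s - Int.fract t| < 1 :=
  abs_sub_lt_of_nonneg_of_lt (Int.fract_nonneg s) (Int.fract_lt_one s) (Int.fract_nonneg t)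
    (Int.fract_lt_one t)

section carry

variable {h h' h₁ h₂ t : ℤ} (ht : h - h' = t * (h₁ - h₂))
include ht

theorem carry_eq (w : ℝ) : (carry h h' h₁ h₂ t w : ℝ) =
    t * (Int.fract (h₁ * w) - Int.fract (h₂ * w)) - (Int.fract (h * w) - Int.fract (h' * w)) := by
  have ht' : (h - h' : ℝ) = t * (h₁ - h₂) := by exact_mod_cast ht
  simp only [carry, Int.fract]
  push_cast
  linear_combination w * ht'

theorem abs_carry_le (w : ℝ) : |(carry h h' h₁ h₂ t w : ℝ)| ≤ 1 + |(t : ℝ)| := by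
  rw [carry_eq ht, add_comm]
  refine (abs_sub _ _).trans (add_le_add ?_ (abs_fract_sub_fract_lt_one _ _).le)
  rw [abs_mul]
  exact mul_le_of_le_one_right (abs_nonneg _) (abs_fract_sub_fract_lt_one _ _).le

theorem carry_ne_zero {w : ℝ}
    (hw : 1 ≤ |(t : ℝ)| * |Int.fract (h₁ * w) - Int.fract (h₂ * w)|) :
    carry h h' h₁ h₂ t w ≠ 0 := by
  intro h0
  have heq := carry_eq ht w
  rw [h0, Int.cast_zero, eq_comm, sub_eq_zero] at heq
  rw [← abs_mul, heq] at hw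
  exact hw.not_gt (abs_fract_sub_fract_lt_one _ _)

theorem carry_mul_sub_carry_mul (x z : ℝ) :
    (carry h h' h₁ h₂ t x : ℝ) * z - carry h h' h₁ h₂ t z * x =
      bracketForm x z h - bracketForm x z h' - t * (bracketForm x z h₁ - bracketForm x z h₂) := by
  rw [carry_eq ht, carry_eq ht]
  unfold bracketForm
  ring

theorem NoIntegerRelation.lt_of_carry {x z β ρ Q r : ℝ} (hrel : NoIntegerRelation x z Q r) {ξ : ℤ}
    (hξ : ξ ≠ 0) (hQ : |(ξ : ℝ)| * (1 + |(t : ℝ)|) ≤ Q)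
    (hw : 1 ≤ |(t : ℝ)| * |Int.fract (h₁ * x) - Int.fract (h₂ * x)|)
    (hρ : ∀ k ∈ ({h, h', h₁, h₂} : Finset ℤ),
      ‖((ξ * bracketForm x z k + β : ℝ) : UnitAddCircle)‖ ≤ ρ) :
    r < (2 + 2 * |(t : ℝ)|) * ρ := by
  set cx := carry h h' h₁ h₂ t x
  set cz := carry h h' h₁ h₂ t z
  have hbound : ∀ w, |((ξ * carry h h' h₁ h₂ t w : ℤ) : ℝ)| ≤ Q := by
    intro w
    rw [Int.cast_mul, abs_mul]
    exact (mul_le_mul_of_nonneg_left (abs_carry_le ht w) (abs_nonneg _)).trans hQ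
  have hlt := hrel (-(ξ * cz)) (ξ * cx) (Or.inr (mul_ne_zero hξ (carry_ne_zero ht hw)))
    (by rw [Int.cast_neg, abs_neg]; exact hbound z) (hbound x)
  set θ : ℤ → ℝ := fun k => ξ * bracketForm x z k + β with hθ
  have hsum : ((-(ξ * cz) : ℤ) : ℝ) * x + ((ξ * cx : ℤ) : ℝ) * z =
      (θ h - θ h') - t • (θ h₁ - θ h₂) := by
    simp only [hθ, zsmul_eq_mul]
    push_cast
    linear_combination (ξ : ℝ) * carry_mul_sub_carry_mul ht x z
  have hdiff : ∀ k ∈ ({h, h', h₁, h₂} : Finset ℤ), ∀ k' ∈ ({h, h', h₁, h₂} : Finset ℤ),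
      ‖((θ k - θ k' : ℝ) : UnitAddCircle)‖ ≤ 2 * ρ := by
    intro k hk k' hk'
    rw [AddCircle.coe_sub, two_mul]
    exact (norm_sub_le _ _).trans (add_le_add (hρ k hk) (hρ k' hk'))
  rw [hsum, AddCircle.coe_sub, AddCircle.coe_zsmul] at hlt
  calc r < _ := hlt
    _ ≤ 2 * ρ + |(t : ℝ)| * (2 * ρ) := by
        refine (norm_sub_le _ _).trans (add_le_add (hdiff h (by simp) h' (by simp)) ?_)
        refine (norm_zsmul_le _ _).trans ?_
        rw [Int.norm_eq_abs]
        exact mul_le_mul_of_nonneg_left (hdiff h₁ (by simp) h₂ (by simp)) (abs_nonneg _)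
    _ = (2 + 2 * |(t : ℝ)|) * ρ := by ring

end carry

theorem exists_sub_eq_mul_of_card_lt {H : Finset ℤ} {N K : ℕ} {d : ℤ}
    (hH : H ⊆ Finset.Ioo (-(N : ℤ)) N) (hd : K * |d| ≤ N) (hcard : 4 * N + 1 < H.card * (K + 1)) :
    ∃ h ∈ H, ∃ h' ∈ H, ∃ s : ℤ, s ≠ 0 ∧ |s| ≤ K ∧ h - h' = s * d := by
  have hpigeon : (Finset.Icc (-(2 * N : ℤ)) (2 * N)).card <
      (H ×ˢ Finset.range (K + 1)).card := by
    rw [Finset.card_product, Finset.card_range, Int.card_Icc]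
    omega
  have hmaps : Set.MapsTo (fun p : ℤ × ℕ => p.1 + p.2 * d) ↑(H ×ˢ Finset.range (K + 1))
      ↑(Finset.Icc (-(2 * N : ℤ)) (2 * N)) := by
    rintro ⟨h, i⟩ hp
    simp only [Finset.coe_product, Set.mem_prod, Finset.mem_coe, Finset.mem_range] at hp
    have hh := Finset.mem_Ioo.1 (hH hp.1)
    have hid : |(i : ℤ) * d| ≤ N := by
      rw [abs_mul, Nat.abs_cast]
      exact (mul_le_mul_of_nonneg_right (by omega) (abs_nonneg d)).trans hd
    rw [abs_le] at hid
    simp only [Finset.coe_Icc, Set.mem_Icc]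
    omega
  obtain ⟨⟨h, i⟩, hp, ⟨h', i'⟩, hp', hne, heq⟩ :=
    Finset.exists_ne_map_eq_of_card_lt_of_maps_to hpigeon hmaps
  simp only [Finset.mem_product, Finset.mem_range] at hp hp' heq
  have hii : (i' : ℤ) - i ≠ 0 := by
    intro h0
    obtain rfl : i' = i := by omega
    exact hne (by rw [add_right_cancel heq])
  exact ⟨h, hp.1, h', hp'.1, i' - i, hii, abs_le.2 (by omega), by linear_combination heq⟩

theorem card_le_of_card_ediv_fiber_le {H : Finset ℤ} {N l m : ℕ} {D : ℝ} (hl : 0 < l)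
    (hH : H ⊆ Finset.Ioo (-(N : ℤ)) N) (hN : N ≤ m * l)
    (hD : ∀ q : ℤ, (({h ∈ H | h / (l : ℤ) = q} : Finset ℤ).card : ℝ) ≤ D) :
    (H.card : ℝ) ≤ 2 * m * D := by
  have hl' : (0 : ℤ) < l := by exact_mod_cast hl
  have : (N : ℤ) ≤ m * l := by exact_mod_cast hN
  have hmaps : ∀ h ∈ H, h / (l : ℤ) ∈ Finset.Ico (-(m : ℤ)) m := by
    intro h hh
    have := Finset.mem_Ioo.1 (hH hh)
    rw [Finset.mem_Ico, Int.le_ediv_iff_mul_le hl', Int.ediv_lt_iff_lt_mul hl']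
    constructor <;> linarith
  have hcard : (Finset.Ico (-(m : ℤ)) m).card = 2 * m := by rw [Int.card_Ico]; omega
  rw [Finset.card_eq_sum_card_fiberwise hmaps, Nat.cast_sum]
  refine (Finset.sum_le_card_nsmul _ _ D fun q _ => hD q).trans_eq ?_
  rw [hcard, nsmul_eq_mul]
  push_cast
  ring

theorem norm_coe_sub_le_abs_fract_sub (s t : ℝ) :
    ‖((s - t : ℝ) : UnitAddCircle)‖ ≤ |Int.fract s - Int.fract t| := by
  have h : s - t = Int.fract s - Int.fract t + ((⌊s⌋ - ⌊t⌋ : ℤ) : ℝ) := by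
    push_cast
    linear_combination -Int.fract_add_floor s + Int.fract_add_floor t
  rw [h, coe_add_intCast_unitAddCircle]
  exact norm_coe_unitAddCircle_le_abs _

theorem abs_sub_lt_of_ediv_eq {h₁ h₂ l : ℤ} (hl : 0 < l) (hdiv : h₁ / l = h₂ / l) :
    |h₁ - h₂| < l := by
  have e₁ := Int.mul_ediv_add_emod h₁ l
  have e₂ := Int.mul_ediv_add_emod h₂ l
  have hsub : h₁ - h₂ = h₁ % l - h₂ % l := by rw [hdiv] at e₁; linarith
  rw [hsub]
  exact abs_sub_lt_of_nonneg_of_lt (Int.emod_nonneg _ hl.ne') (Int.emod_lt_of_pos _ hl)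
    (Int.emod_nonneg _ hl.ne') (Int.emod_lt_of_pos _ hl)

theorem card_ediv_fiber_le_of_abs_fract_sub_le {x r : ℝ} {K l : ℕ} (hK : 0 < K) (hl : 0 < l)
    (hr : 0 < r) (hx : ∀ k : ℤ, k ≠ 0 → |k| < K → r ≤ ‖((k * x : ℝ) : UnitAddCircle)‖)
    {H : Finset ℤ} (hclose : ∀ h₁ ∈ H, ∀ h₂ ∈ H, h₁ / (l : ℤ) = h₂ / l →
      |Int.fract (h₁ * x) - Int.fract (h₂ * x)| ≤ 1 / (8 * K)) (q : ℤ) :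
    (({h ∈ H | h / (l : ℤ) = q} : Finset ℤ).card : ℝ) ≤ 4 * l / K + 4 / r := by
  set S : Finset ℤ := {h ∈ H | h / (l : ℤ) = q} with hS
  rcases S.eq_empty_or_nonempty with hempty | ⟨h₀, hh₀⟩
  · rw [hempty, Finset.card_empty, Nat.cast_zero]
    positivity
  have hl' : (0 : ℤ) < l := by exact_mod_cast hl
  have hblock : S ⊆ Finset.Icc (q * l) (q * l + l - 1) := by
    intro h hh
    obtain ⟨-, rfl⟩ := Finset.mem_filter.1 hh
    have hdiv := Int.mul_ediv_add_emod h l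
    have hnonneg := Int.emod_nonneg h hl'.ne'
    have hlt := Int.emod_lt_of_pos h hl'
    rw [Finset.mem_Icc]
    constructor <;> linarith
  have hnear : ∀ h ∈ S, ‖((h * x - h₀ * x : ℝ) : UnitAddCircle)‖ ≤ 1 / (8 * K) := by
    intro h hh
    rw [hS, Finset.mem_filter] at hh hh₀
    exact (norm_coe_sub_le_abs_fract_sub _ _).trans
      (hclose h hh.1 h₀ hh₀.1 (hh.2.trans hh₀.2.symm))
  have hlen : (Finset.Icc (q * l : ℤ) (q * l + l - 1)).card = l := by
    rw [Int.card_Icc]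
    omega
  simpa only [hlen] using card_le_of_norm_mul_sub_le hK hr hx hblock hnear

theorem card_mul_le_of_spread {x z β ρ Q r : ℝ} {N K : ℕ} {ξ h₁ h₂ : ℤ} (hK : 0 < K) (hξ : ξ ≠ 0)
    (hrel : NoIntegerRelation x z Q r) (hQ : |(ξ : ℝ)| * (1 + 8 * K ^ 2) ≤ Q)
    (hρ : (2 + 16 * K ^ 2) * ρ ≤ r) {H : Finset ℤ} (hHN : H ⊆ Finset.Ioo (-(N : ℤ)) N)
    (hH : ∀ h ∈ H, ‖((ξ * bracketForm x z h + β : ℝ) : UnitAddCircle)‖ ≤ ρ) (hh₁ : h₁ ∈ H)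
    (hh₂ : h₂ ∈ H) (hclose : 8 * K ^ 2 * |h₁ - h₂| ≤ N)
    (hspread : 1 / (8 * K) ≤ |Int.fract (h₁ * x) - Int.fract (h₂ * x)|) :
    H.card * (K + 1) ≤ 4 * N + 1 := by
  by_contra! hcard
  have : (0 : ℝ) < K := by exact_mod_cast hK
  have hd : K * |8 * K * (h₁ - h₂)| ≤ N := by
    rw [abs_mul, abs_of_nonneg (by positivity : (0 : ℤ) ≤ 8 * K)]
    linarith
  obtain ⟨h, hh, h', hh', s, hs, hsK, hsub⟩ := exists_sub_eq_mul_of_card_lt hHN hd hcard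
  have hs1 : (1 : ℝ) ≤ |(s : ℝ)| := by exact_mod_cast Int.one_le_abs hs
  have hsK' : |(s : ℝ)| ≤ K := by exact_mod_cast hsK
  have habs : |((s * (8 * K) : ℤ) : ℝ)| = |(s : ℝ)| * (8 * K) := by
    push_cast
    rw [abs_mul, abs_of_pos (by positivity : (0 : ℝ) < 8 * K)]
  have ht : |((s * (8 * K) : ℤ) : ℝ)| ≤ 8 * K ^ 2 := by
    rw [habs]
    nlinarith
  have hmem : ∀ k ∈ ({h, h', h₁, h₂} : Finset ℤ), k ∈ H := by
    simp [hh, hh', hh₁, hh₂]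
  have hlt := hrel.lt_of_carry (t := s * (8 * K)) (by rw [hsub]; ring) hξ
    ((by gcongr : |(ξ : ℝ)| * _ ≤ |(ξ : ℝ)| * (1 + 8 * K ^ 2)).trans hQ)
    (by
      rw [habs]
      calc (1 : ℝ) = 1 * (8 * K) * (1 / (8 * K)) := by field_simp
        _ ≤ _ := by gcongr)
    (fun k hk => hH k (hmem k hk))
  have hρ0 : 0 ≤ ρ := (norm_nonneg _).trans (hH h hh)
  nlinarith [mul_le_mul_of_nonneg_right ht hρ0]

theorem card_le_of_abs_fract_sub_le {x r : ℝ} {N K l : ℕ} (hK : 0 < K) (hl : 0 < l) (hr : 0 < r)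
    (hx : ∀ k : ℤ, k ≠ 0 → |k| < K → r ≤ ‖((k * x : ℝ) : UnitAddCircle)‖)
    (hlN : 8 * K ^ 2 * l ≤ N) (hNl : N ≤ 2 * (8 * K ^ 2) * l) (hN : 8 * (K : ℝ) ^ 3 ≤ r * N)
    {H : Finset ℤ} (hHN : H ⊆ Finset.Ioo (-(N : ℤ)) N)
    (hclose : ∀ h₁ ∈ H, ∀ h₂ ∈ H, h₁ / (l : ℤ) = h₂ / l →
      |Int.fract (h₁ * x) - Int.fract (h₂ * x)| ≤ 1 / (8 * K)) :
    (H.card : ℝ) ≤ 32 * N / K := by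
  have : (8 * K ^ 2 * l : ℝ) ≤ N := by exact_mod_cast hlN
  have hrN : 8 * (K : ℝ) ^ 2 / r ≤ N / K := by
    rw [div_le_div_iff₀ hr (by positivity)]
    linarith
  calc (H.card : ℝ) ≤ 2 * ((2 * (8 * K ^ 2) : ℕ) : ℝ) * (4 * l / K + 4 / r) :=
        card_le_of_card_ediv_fiber_le hl hHN hNl
          (card_ediv_fiber_le_of_abs_fract_sub_le hK hl hr hx hclose)
    _ = 16 * (8 * K ^ 2 * l / K) + 16 * (8 * K ^ 2 / r) := by
        push_cast
        ring
    _ ≤ 16 * (N / K) + 16 * (N / K) := by gcongr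
    _ = 32 * N / K := by ring

theorem exists_mul_le_and_le_two_mul_mul {T N : ℕ} (hT : 0 < T) (hTN : T ≤ N) :
    ∃ l, 0 < l ∧ T * l ≤ N ∧ N ≤ 2 * T * l := by
  have hl : 0 < N / T := Nat.div_pos hTN hT
  have hlt := Nat.lt_mul_div_succ N hT
  exact ⟨N / T, hl, Nat.mul_div_le N T, by nlinarith⟩

/-- Either the values of `h x` on each block of length about `N / 8 K ^ 2` cluster modulo one, in
which case there are few of them, or the pigeonhole principle produces four indices with nonzero
carry. -/
theorem card_bracketForm_le {x z β ρ Q r : ℝ} {N K : ℕ} {ξ : ℤ} (hK : 0 < K) (hξ : ξ ≠ 0)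
    (hrel : NoIntegerRelation x z Q r) (hQ : |(ξ : ℝ)| * (1 + 8 * K ^ 2) ≤ Q)
    (hρ : (2 + 16 * K ^ 2) * ρ ≤ r) (hN : 8 * (K : ℝ) ^ 3 ≤ r * N) {H : Finset ℤ}
    (hHN : H ⊆ Finset.Ioo (-(N : ℤ)) N)
    (hH : ∀ h ∈ H, ‖((ξ * bracketForm x z h + β : ℝ) : UnitAddCircle)‖ ≤ ρ) :
    (H.card : ℝ) ≤ 32 * N / K := by
  have hK' : (1 : ℝ) ≤ K := by exact_mod_cast hK
  have hξ' : (1 : ℝ) ≤ |(ξ : ℝ)| := by exact_mod_cast Int.one_le_abs hξ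
  have hKQ : 1 + 8 * (K : ℝ) ^ 2 ≤ Q := (le_mul_of_one_le_left (by positivity) hξ').trans hQ
  have hr : 0 < r := pos_of_mul_pos_left (lt_of_lt_of_le (by positivity) hN) (Nat.cast_nonneg N)
  have hr2 : r < 1 / 2 := hrel.lt_one_half (by nlinarith)
  have hKN : 8 * K ^ 2 ≤ N := by
    have h : (8 * K ^ 2 : ℝ) ≤ N := by nlinarith
    exact_mod_cast h
  obtain ⟨l, hl, hlN, hNl⟩ := exists_mul_le_and_le_two_mul_mul (by positivity) hKN
  by_cases hspread : ∃ h₁ ∈ H, ∃ h₂ ∈ H, h₁ / (l : ℤ) = h₂ / l ∧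
      1 / (8 * K) ≤ |Int.fract (h₁ * x) - Int.fract (h₂ * x)|
  · obtain ⟨h₁, hh₁, h₂, hh₂, hdiv, hfract⟩ := hspread
    have hclose : 8 * K ^ 2 * |h₁ - h₂| ≤ N := by
      have hlt := abs_sub_lt_of_ediv_eq (by exact_mod_cast hl) hdiv
      calc (8 * K ^ 2 * |h₁ - h₂| : ℤ) ≤ (8 * K ^ 2 * l : ℤ) := by gcongr
        _ ≤ N := by exact_mod_cast hlN
    have hcard : (H.card * (K + 1) : ℝ) ≤ 4 * N + 1 := by
      exact_mod_cast card_mul_le_of_spread hK hξ hrel hQ hρ hHN hH hh₁ hh₂ hclose hfract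
    have hN1 : (1 : ℝ) ≤ N := by
      exact_mod_cast (show 0 < 8 * K ^ 2 by positivity).trans_le hKN
    rw [le_div_iff₀ (by positivity)]
    linarith [(Nat.cast_nonneg H.card : (0 : ℝ) ≤ H.card)]
  · push Not at hspread
    have hx : ∀ k : ℤ, k ≠ 0 → |k| < K → r ≤ ‖((k * x : ℝ) : UnitAddCircle)‖ := by
      intro k hk hkK
      have hkK' : |(k : ℝ)| < K := by exact_mod_cast hkK
      exact (hrel.lt_norm_mul_left hk (by nlinarith)).le
    exact card_le_of_abs_fract_sub_le hK hl hr hx hlN hNl hN hHN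
      fun h₁ hh₁ h₂ hh₂ hdiv => (hspread h₁ hh₁ h₂ hh₂ hdiv).le

/-! ### Discrepancy of a finite sequence -/

section

variable {X : Type*} [MeasurableSpace X]

/-- The difference between the average of `F` along `x 1, …, x N` and its integral. -/
def discrepancy (μ : Measure X) (x : ℤ → X) (N : ℕ) (F : X → ℂ) : ℂ :=
  (∑ n ∈ Finset.Icc (1 : ℤ) N, F (x n)) / (N : ℂ) - ∫ p, F p ∂μ

variable {μ : Measure X} {x : ℤ → X} {N : ℕ} {F G : X → ℂ} {B r : ℝ}

theorem discrepancy_const_mul (c : ℂ) :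
    discrepancy μ x N (fun p => c * F p) = c * discrepancy μ x N F := by
  rw [discrepancy, discrepancy, ← Finset.mul_sum, integral_const_mul, mul_div_assoc, mul_sub]

theorem discrepancy_sub (hF : Integrable F μ) (hG : Integrable G μ) :
    discrepancy μ x N (fun p => F p - G p) = discrepancy μ x N F - discrepancy μ x N G := by
  simp only [discrepancy, Finset.sum_sub_distrib, integral_sub hF hG]
  ring

theorem discrepancy_sum_mul {ι : Type*} (s : Finset ι) (c : ι → ℂ) {f : ι → X → ℂ}
    (hf : ∀ i ∈ s, Integrable (f i) μ) :
    discrepancy μ x N (fun p => ∑ i ∈ s, c i * f i p) = ∑ i ∈ s, c i * discrepancy μ x N (f i) := by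
  simp only [discrepancy, mul_sub, Finset.sum_sub_distrib]
  rw [integral_finsetSum s fun i hi => (hf i hi).const_mul (c i), Finset.sum_comm, Finset.sum_div]
  simp only [integral_const_mul, ← Finset.mul_sum, mul_div_assoc]

theorem norm_discrepancy_le [IsProbabilityMeasure μ] (hB : ∀ p, ‖F p‖ ≤ B) :
    ‖discrepancy μ x N F‖ ≤ 2 * B := by
  have hsum : ‖∑ n ∈ Finset.Icc (1 : ℤ) N, F (x n)‖ ≤ B * N := by
    simpa [mul_comm] using norm_sum_le_of_le (Finset.Icc (1 : ℤ) N) fun n _ => hB (x n)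
  have havg : ‖(∑ n ∈ Finset.Icc (1 : ℤ) N, F (x n)) / (N : ℂ)‖ ≤ B := by
    rw [norm_div, Complex.norm_natCast]
    exact div_le_of_le_mul₀ N.cast_nonneg ((norm_nonneg _).trans (hB (x 0))) hsum
  have hint : ‖∫ p, F p ∂μ‖ ≤ B := by
    simpa using norm_integral_le_of_norm_le_const (μ := μ) (Filter.Eventually.of_forall hB)
  exact (norm_sub_le _ _).trans (by linarith)

theorem norm_discrepancy_le_of_approx [IsProbabilityMeasure μ] {ι : Type*} {s : Finset ι}
    {c : ι → ℂ} {f : ι → X → ℂ} {D : ℝ} (hF : Integrable F μ) (hf : ∀ i ∈ s, Integrable (f i) μ)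
    (hr : ∀ p, ‖F p - ∑ i ∈ s, c i * f i p‖ ≤ r) (hc : ∀ i ∈ s, ‖c i‖ ≤ 1)
    (hD : ∀ i ∈ s, ‖discrepancy μ x N (f i)‖ ≤ D) :
    ‖discrepancy μ x N F‖ ≤ 2 * r + s.card * D := by
  have hG : Integrable (fun p => ∑ i ∈ s, c i * f i p) μ :=
    integrable_finsetSum s fun i hi => (hf i hi).const_mul (c i)
  have hsub : ‖discrepancy μ x N F - ∑ i ∈ s, c i * discrepancy μ x N (f i)‖ ≤ 2 * r := by
    rw [← discrepancy_sum_mul s c hf, ← discrepancy_sub hF hG]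
    exact norm_discrepancy_le hr
  have hsum : ‖∑ i ∈ s, c i * discrepancy μ x N (f i)‖ ≤ s.card * D := by
    rw [← nsmul_eq_mul, ← Finset.sum_const]
    refine norm_sum_le_of_le _ fun i hi => ?_
    rw [norm_mul]
    exact (mul_le_of_le_one_left (norm_nonneg _) (hc i hi)).trans (hD i hi)
  have htri := norm_sub_norm_le (discrepancy μ x N F) (∑ i ∈ s, c i * discrepancy μ x N (f i))
  linarith

end

namespace Heis

/-! ### The centre and Lipschitz functions on the nilmanifold -/

/-- The one-parameter group `c ↦ exp (c X₃)`, which is the centre of the Heisenberg group. -/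
def cen (c : ℝ) : Heis := ⟨0, c, 0⟩

@[simp] theorem cen_x (c : ℝ) : (cen c).x = 0 := rfl
@[simp] theorem cen_y (c : ℝ) : (cen c).y = c := rfl
@[simp] theorem cen_z (c : ℝ) : (cen c).z = 0 := rfl

theorem cen_mul_comm (c : ℝ) (g : Heis) : cen c * g = g * cen c := by
  ext <;> simp only [mul_x, mul_y, mul_z, cen_x, cen_y, cen_z] <;> ring

theorem cen_add (c d : ℝ) : cen (c + d) = cen c * cen d := by ext <;> simp

theorem cen_intCast_mem (n : ℤ) : cen n ∈ Γ := ⟨⟨0, by simp⟩, ⟨n, rfl⟩, ⟨0, by simp⟩⟩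

theorem smul_mk (u g : Heis) : u • (QuotientGroup.mk g : Nil) = QuotientGroup.mk (u * g) := rfl

theorem cen_smul_comm (c : ℝ) (g : Heis) (p : Nil) : cen c • g • p = g • cen c • p := by
  rw [smul_smul, cen_mul_comm, ← smul_smul]

theorem cen_add_intCast_smul (c : ℝ) (n : ℤ) (p : Nil) : cen (c + n) • p = cen c • p := by
  induction p using QuotientGroup.induction_on with
  | H g =>
    rw [smul_mk, smul_mk, cen_add, mul_assoc, cen_mul_comm n, ← mul_assoc,
      QuotientGroup.mk_mul_of_mem _ (cen_intCast_mem n)]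

theorem mk_eq_cen_smul (g : Heis) :
    (QuotientGroup.mk g : Nil) = cen g.y • (QuotientGroup.mk ⟨g.x, 0, g.z⟩ : Nil) := by
  rw [smul_mk]
  congr 1
  ext <;> simp

theorem norm_psi_le {u : Heis} {r : ℝ} (hr : 0 ≤ r) (hx : |u.x| ≤ r) (hz : |u.z| ≤ r)
    (hy : |u.y - u.x * u.z| ≤ r) : ‖psi u‖ ≤ r := by
  rw [pi_norm_le_iff_of_nonneg hr]
  intro i
  fin_cases i
  exacts [hx, hz, hy]

theorem abs_x_le_norm_psi (u : Heis) : |u.x| ≤ ‖psi u‖ := norm_le_pi_norm (psi u) 0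

theorem abs_z_le_norm_psi (u : Heis) : |u.z| ≤ ‖psi u‖ := norm_le_pi_norm (psi u) 1

theorem abs_y_sub_le_norm_psi (u : Heis) : |u.y - u.x * u.z| ≤ ‖psi u‖ :=
  norm_le_pi_norm (psi u) 2

theorem psi_one : psi 1 = 0 := by
  funext i
  fin_cases i <;> simp [psi]

theorem continuous_psi : Continuous psi := by
  refine continuous_pi fun i => ?_
  fin_cases i
  exacts [continuous_x, continuous_z, continuous_y.sub (continuous_x.mul continuous_z)]

theorem norm_psi_cen (c : ℝ) : ‖psi (cen c)‖ = |c| :=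
  le_antisymm (norm_psi_le (abs_nonneg c) (by simp) (by simp) (by simp))
    (by simpa using abs_y_sub_le_norm_psi (cen c))

theorem norm_psi_conj_le {b : Heis} (hx : |b.x| ≤ 1) (hz : |b.z| ≤ 1) (u : Heis) :
    ‖psi (b * u * b⁻¹)‖ ≤ 3 * ‖psi u‖ := by
  have hux := abs_x_le_norm_psi u
  have huz := abs_z_le_norm_psi u
  have huy := abs_y_sub_le_norm_psi u
  have h₀ := norm_nonneg (psi u)
  have hthird : (b * u * b⁻¹).y - (b * u * b⁻¹).x * (b * u * b⁻¹).z =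
      (u.y - u.x * u.z) + (b.x * u.z - b.z * u.x) := by
    simp only [mul_x, mul_y, mul_z, inv_x, inv_y, inv_z]
    ring
  have hxz : |b.x * u.z| ≤ ‖psi u‖ := by
    rw [abs_mul]
    exact (mul_le_of_le_one_left (abs_nonneg _) hx).trans huz
  have hzx : |b.z * u.x| ≤ ‖psi u‖ := by
    rw [abs_mul]
    exact (mul_le_of_le_one_left (abs_nonneg _) hz).trans hux
  refine norm_psi_le (by positivity) (by simpa using hux.trans (by linarith))
    (by simpa using huz.trans (by linarith)) ?_
  rw [hthird]
  have hadd := abs_add_le (u.y - u.x * u.z) (b.x * u.z - b.z * u.x)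
  have hsub := abs_sub (b.x * u.z) (b.z * u.x)
  linarith

/-- Functions on the nilmanifold that move by at most `L * ‖ψ(u)‖` under translation by `u`. Every
Lipschitz `F` has this property with `L = lipNorm F`. -/
def SMulLipschitz (L : ℝ) (F : Nil → ℂ) : Prop :=
  ∀ (u : Heis) (p : Nil), ‖F (u • p) - F p‖ ≤ L * ‖psi u‖

section

variable {F : Nil → ℂ} {L B : ℝ}

theorem SMulLipschitz.nonneg (hF : SMulLipschitz L F) : 0 ≤ L := by
  simpa [norm_psi_cen] using (norm_nonneg _).trans (hF (cen 1) (QuotientGroup.mk 1))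

theorem continuous_of_comp_mk (h : Continuous fun g : Heis => F (QuotientGroup.mk g)) :
    Continuous F :=
  (QuotientGroup.isQuotientMap_mk (N := Γ)).continuous_iff.2 h

theorem SMulLipschitz.continuous (hF : SMulLipschitz L F) : Continuous F := by
  refine continuous_of_comp_mk (continuous_iff_continuousAt.2 fun g => ?_)
  have hlim : Filter.Tendsto (fun h : Heis => L * ‖psi (h * g⁻¹)‖) (nhds g) (nhds 0) := by
    have hcont : Continuous fun h : Heis => L * ‖psi (h * g⁻¹)‖ := by
      have := continuous_psi
      fun_prop
    simpa [psi_one] using hcont.tendsto g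
  rw [ContinuousAt, tendsto_iff_norm_sub_tendsto_zero]
  refine squeeze_zero (fun _ => norm_nonneg _) (fun h => ?_) hlim
  simpa only [smul_mk, inv_mul_cancel_right] using hF (h * g⁻¹) (QuotientGroup.mk g)

theorem SMulLipschitz.integrable (hF : SMulLipschitz L F) (hB : ∀ p, ‖F p‖ ≤ B) :
    Integrable F nilHaar :=
  .of_bound hF.continuous.aestronglyMeasurable B (.of_forall hB)

theorem SMulLipschitz.circleLipschitz_cen (hF : SMulLipschitz L F) (p : Nil) :
    CircleLipschitz L fun c => F (cen c • p) := by
  intro c d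
  have hc : cen c • p = cen (c - d - round (c - d)) • cen d • p := by
    rw [smul_smul, ← cen_add, ← cen_add_intCast_smul (_ + d) (round (c - d))]
    ring_nf
  simp only [hc]
  rw [UnitAddCircle.norm_eq, ← norm_psi_cen]
  exact hF _ _

theorem integral_eq_zero_of_smul_eq_mul {c : ℂ} (hc : c ≠ 1) (u : Heis)
    (hF : ∀ p, F (u • p) = c * F p) : ∫ p, F p ∂nilHaar = 0 := by
  have h := integral_smul_eq_self (μ := nilHaar) F (g := u)
  simp_rw [hF] at h
  rw [integral_const_mul, mul_left_eq_self₀] at h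
  exact h.resolve_left hc

/-! ### Fourier expansion along the centre -/

/-- Functions on which the centre acts through its character of frequency `ξ`. -/
def HasCentralFrequency (ξ : ℤ) (F : Nil → ℂ) : Prop :=
  ∀ (c : ℝ) (p : Nil), F (cen c • p) = 𝐞 (ξ * c) * F p

theorem HasCentralFrequency.cen_smul (hF : HasCentralFrequency 0 F) (c : ℝ) (p : Nil) :
    F (cen c • p) = F p := by
  simpa using hF c p

theorem HasCentralFrequency.integral_eq_zero {ξ : ℤ} (hF : HasCentralFrequency ξ F)
    (hξ : ξ ≠ 0) : ∫ p, F p ∂nilHaar = 0 := by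
  have hξ' : (ξ : ℝ) ≠ 0 := by exact_mod_cast hξ
  have hhalf : (ξ : ℝ) * (1 / (2 * ξ)) = 1 / 2 := by field_simp
  refine integral_eq_zero_of_smul_eq_mul (c := -1) (by norm_num) (cen (1 / (2 * ξ))) fun p => ?_
  rw [hF, hhalf, coe_fourierChar_one_half]

/-- The component of `F` of central frequency `ξ`. -/
def centralComponent (ξ : ℤ) (F : Nil → ℂ) (p : Nil) : ℂ :=
  circleFourierCoeff (fun c => F (cen c • p)) ξ

theorem norm_centralComponent_le (hB : ∀ p, ‖F p‖ ≤ B) (ξ : ℤ) (p : Nil) :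
    ‖centralComponent ξ F p‖ ≤ B :=
  norm_circleFourierCoeff_le (fun _ => hB _) ξ

theorem SMulLipschitz.centralComponent (hF : SMulLipschitz L F) (ξ : ℤ) :
    SMulLipschitz L (centralComponent ξ F) := by
  intro u p
  rw [Heis.centralComponent, Heis.centralComponent, ← circleFourierCoeff_sub
    (hF.circleLipschitz_cen _).continuous (hF.circleLipschitz_cen _).continuous]
  refine norm_circleFourierCoeff_le (fun c => ?_) ξ
  rw [cen_smul_comm]
  exact hF _ _

theorem SMulLipschitz.hasCentralFrequency_centralComponent (hF : SMulLipschitz L F) (ξ : ℤ) :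
    HasCentralFrequency ξ (Heis.centralComponent ξ F) := by
  intro d p
  rw [Heis.centralComponent, Heis.centralComponent,
    ← circleFourierCoeff_comp_add (hF.circleLipschitz_cen p).periodic]
  simp only [smul_smul, ← cen_add, add_comm]

theorem SMulLipschitz.norm_sub_sum_centralComponent_le (hF : SMulLipschitz L F) {m : ℕ}
    (hm : 0 < m) (p : Nil) :
    ‖F p - ∑ ξ ∈ Finset.Ioo (-(m : ℤ)) m, fejerCoeff m ξ * Heis.centralComponent ξ F p‖ ≤
      L / √m := by
  have hlip := hF.circleLipschitz_cen p
  have h := hlip.norm_sub_fejerMean_le hm 0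
  have hone : cen 0 = 1 := rfl
  simpa only [Heis.centralComponent, fejerMean_eq_sum hlip.continuous hlip.periodic hm, hone,
    one_smul, mul_zero, AddChar.map_zero_eq_one, Circle.coe_one, mul_one] using h

end

/-! ### The horizontal torus -/

section

variable {Φ : Nil → ℂ} {L B : ℝ}

theorem SMulLipschitz.norm_sub_le_of_hasCentralFrequency_zero (hΦ : SMulLipschitz L Φ)
    (h₀ : HasCentralFrequency 0 Φ) (g g' : Heis) :
    ‖Φ (QuotientGroup.mk g) - Φ (QuotientGroup.mk g')‖ ≤
      L * max ‖((g.x - g'.x : ℝ) : UnitAddCircle)‖ ‖((g.z - g'.z : ℝ) : UnitAddCircle)‖ := by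
  set m := round (g.x - g'.x)
  set n := round (g.z - g'.z)
  set γ : Heis := ⟨(-m : ℤ), 0, (-n : ℤ)⟩ with hγ
  have hγΓ : γ ∈ Γ := ⟨⟨_, rfl⟩, ⟨0, by simp [hγ]⟩, ⟨_, rfl⟩⟩
  set u := g * γ * g'⁻¹ with hu
  set s := u.y - u.x * u.z with hs
  have hmk : (QuotientGroup.mk g : Nil) = u • (QuotientGroup.mk g' : Nil) := by
    rw [smul_mk, hu, inv_mul_cancel_right, QuotientGroup.mk_mul_of_mem _ hγΓ]
  have h := hΦ (cen (-s) * u) (QuotientGroup.mk g')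
  rw [← smul_smul, h₀.cen_smul, ← hmk] at h
  refine h.trans (mul_le_mul_of_nonneg_left ?_ hΦ.nonneg)
  have hx : (cen (-s) * u).x = g.x - g'.x - m := by
    simp only [hu, hγ, mul_x, cen_x, inv_x, Int.cast_neg]
    ring
  have hz : (cen (-s) * u).z = g.z - g'.z - n := by
    simp only [hu, hγ, mul_z, cen_z, inv_z, Int.cast_neg]
    ring
  have hy : (cen (-s) * u).y - (cen (-s) * u).x * (cen (-s) * u).z = 0 := by simp [hs]
  rw [UnitAddCircle.norm_eq, UnitAddCircle.norm_eq]
  refine norm_psi_le (by positivity) ?_ ?_ (by rw [hy, abs_zero]; positivity)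
  · exact hx ▸ le_max_left _ _
  · exact hz ▸ le_max_right _ _

/-- A function on the nilmanifold in the horizontal coordinates `x` and `z`. -/
def inHorizontalCoords (Φ : Nil → ℂ) (s t : ℝ) : ℂ := Φ (QuotientGroup.mk ⟨s, 0, t⟩)

theorem SMulLipschitz.circleLipschitz_left (hΦ : SMulLipschitz L Φ)
    (h₀ : HasCentralFrequency 0 Φ) (t : ℝ) :
    CircleLipschitz L fun s => inHorizontalCoords Φ s t := fun s s' => by
  simpa [inHorizontalCoords] using
    hΦ.norm_sub_le_of_hasCentralFrequency_zero h₀ ⟨s, 0, t⟩ ⟨s', 0, t⟩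

theorem SMulLipschitz.circleLipschitz_right (hΦ : SMulLipschitz L Φ)
    (h₀ : HasCentralFrequency 0 Φ) (s : ℝ) :
    CircleLipschitz L (inHorizontalCoords Φ s) := fun t t' => by
  simpa [inHorizontalCoords] using
    hΦ.norm_sub_le_of_hasCentralFrequency_zero h₀ ⟨s, 0, t⟩ ⟨s, 0, t'⟩

/-- The character `(x, z) ↦ e(k x + l z)` of the horizontal torus, where `kl = (k, l)`, as a
function on the nilmanifold. -/
def torusChar (kl : ℤ × ℤ) : Nil → ℂ :=
  Quotient.lift (fun g : Heis => (𝐞 (kl.1 * g.x + kl.2 * g.z) : ℂ)) fun g g' h => by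
    obtain ⟨⟨m, hm⟩, -, ⟨n, hn⟩⟩ := QuotientGroup.leftRel_apply.1 h
    have hx : g'.x = g.x + m := by rw [← hm, mul_x, inv_x]; ring
    have hz : g'.z = g.z + n := by rw [← hn, mul_z, inv_z]; ring
    have hphase : kl.1 * g'.x + kl.2 * g'.z =
        kl.1 * g.x + kl.2 * g.z + ((kl.1 * m + kl.2 * n : ℤ) : ℝ) := by
      rw [hx, hz]
      push_cast
      ring
    rw [hphase, fourierChar_add_intCast]

theorem torusChar_mk (kl : ℤ × ℤ) (g : Heis) :
    torusChar kl (QuotientGroup.mk g) = 𝐞 (kl.1 * g.x + kl.2 * g.z) := rfl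

theorem torusChar_zero (p : Nil) : torusChar 0 p = 1 := by
  induction p using QuotientGroup.induction_on
  simp [torusChar_mk]

theorem torusChar_smul (kl : ℤ × ℤ) (u : Heis) (p : Nil) :
    torusChar kl (u • p) = 𝐞 (kl.1 * u.x + kl.2 * u.z) * torusChar kl p := by
  induction p using QuotientGroup.induction_on
  rw [smul_mk, torusChar_mk, torusChar_mk, ← coe_fourierChar_add, mul_x, mul_z]
  ring_nf

theorem integrable_torusChar (kl : ℤ × ℤ) : Integrable (torusChar kl) nilHaar := by
  have hcont : Continuous (torusChar kl) := by
    refine continuous_of_comp_mk ?_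
    simp only [torusChar_mk]
    have := continuous_x
    have := continuous_z
    exact continuous_coe_fourierChar.comp (by fun_prop)
  refine .of_bound hcont.aestronglyMeasurable 1 (.of_forall fun p => ?_)
  induction p using QuotientGroup.induction_on
  rw [torusChar_mk, Circle.norm_coe]

theorem integral_torusChar {kl : ℤ × ℤ} (hkl : kl.1 ≠ 0 ∨ kl.2 ≠ 0) :
    ∫ p, torusChar kl p ∂nilHaar = 0 := by
  obtain ⟨u, hu⟩ : ∃ u : Heis, (kl.1 * u.x + kl.2 * u.z : ℝ) = 1 / 2 := by
    rcases hkl with h | h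
    · have : (kl.1 : ℝ) ≠ 0 := by exact_mod_cast h
      exact ⟨⟨1 / (2 * kl.1), 0, 0⟩, by simp only [mul_zero, add_zero]; field_simp⟩
    · have : (kl.2 : ℝ) ≠ 0 := by exact_mod_cast h
      exact ⟨⟨0, 0, 1 / (2 * kl.2)⟩, by simp only [mul_zero, zero_add]; field_simp⟩
  refine integral_eq_zero_of_smul_eq_mul (c := -1) (by norm_num) u fun p => ?_
  rw [torusChar_smul, hu, coe_fourierChar_one_half]

/-- The frequencies occurring in the Fejér kernel of order `M` on the torus. -/
def frequencyBox (M : ℕ) : Finset (ℤ × ℤ) :=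
  Finset.Ioo (-(M : ℤ)) M ×ˢ Finset.Ioo (-(M : ℤ)) M

theorem card_frequencyBox_le (M : ℕ) : ((frequencyBox M).card : ℝ) ≤ 4 * M ^ 2 := by
  have h := card_Ioo_neg_le M
  rw [frequencyBox, Finset.card_product, Nat.cast_mul]
  nlinarith

theorem abs_lt_of_mem_frequencyBox {M : ℕ} {kl : ℤ × ℤ} (h : kl ∈ frequencyBox M) :
    |(kl.1 : ℝ)| < M ∧ |(kl.2 : ℝ)| < M := by
  obtain ⟨hk, hl⟩ := Finset.mem_product.1 h
  exact ⟨by exact_mod_cast abs_lt.2 (Finset.mem_Ioo.1 hk),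
    by exact_mod_cast abs_lt.2 (Finset.mem_Ioo.1 hl)⟩

/-- The coefficient of `torusChar kl` in the Fejér mean of order `M` of a function on the horizontal
torus. -/
def horizontalCoeff (M : ℕ) (Φ : Nil → ℂ) (kl : ℤ × ℤ) : ℂ :=
  torusFejerCoeff M (inHorizontalCoords Φ) kl.1 kl.2

theorem norm_horizontalCoeff_le (hB : ∀ p, ‖Φ p‖ ≤ B) {M : ℕ} {kl : ℤ × ℤ}
    (hkl : kl ∈ frequencyBox M) : ‖horizontalCoeff M Φ kl‖ ≤ B :=
  norm_torusFejerCoeff_le (fun _ _ => hB _) (Finset.mem_product.1 hkl).1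
    (Finset.mem_product.1 hkl).2

theorem SMulLipschitz.norm_sub_sum_torusChar_le (hΦ : SMulLipschitz L Φ)
    (h₀ : HasCentralFrequency 0 Φ) {M : ℕ} (hM : 0 < M) (p : Nil) :
    ‖Φ p - ∑ kl ∈ frequencyBox M, horizontalCoeff M Φ kl * torusChar kl p‖ ≤ 2 * L / √M := by
  induction p using QuotientGroup.induction_on with
  | H g =>
    rw [mk_eq_cen_smul, h₀.cen_smul, ← mk_eq_cen_smul, frequencyBox, Finset.sum_product]
    exact norm_sub_sum_torusFejerCoeff_le (hΦ.circleLipschitz_left h₀)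
      (hΦ.circleLipschitz_right h₀) hM g.x g.z

end

/-! ### Orbits along the horizontal torus -/

theorem zpow_x (a : Heis) (n : ℤ) : (a ^ n).x = n * a.x := by
  induction n using Int.induction_on with
  | zero => simp
  | succ n ih => rw [zpow_add_one, mul_x, ih]; push_cast; ring
  | pred n ih => rw [zpow_sub_one, mul_x, ih, inv_x]; push_cast; ring

theorem zpow_z (a : Heis) (n : ℤ) : (a ^ n).z = n * a.z := by
  induction n using Int.induction_on with
  | zero => simp
  | succ n ih => rw [zpow_add_one, mul_z, ih]; push_cast; ring
  | pred n ih => rw [zpow_sub_one, mul_z, ih, inv_z]; push_cast; ring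

theorem torusChar_mk_zpow (kl : ℤ × ℤ) (a : Heis) (n : ℤ) :
    torusChar kl (QuotientGroup.mk (a ^ n)) = 𝐞 (n * (kl.1 * a.x + kl.2 * a.z)) := by
  rw [torusChar_mk, zpow_x, zpow_z]
  ring_nf

section

variable {a : Heis} {N M : ℕ} {Q : ℝ} {Φ : Nil → ℂ}

theorem norm_discrepancy_torusChar_le (hN : 0 < N) (hQ : 0 < Q)
    (hrel : NoIntegerRelation a.x a.z Q (Q / N)) {kl : ℤ × ℤ} (hk : |(kl.1 : ℝ)| ≤ Q)
    (hl : |(kl.2 : ℝ)| ≤ Q) :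
    ‖discrepancy nilHaar (fun n => QuotientGroup.mk (a ^ n)) N (torusChar kl)‖ ≤ 1 / (2 * Q) := by
  have hN' : (0 : ℝ) < N := by exact_mod_cast hN
  rcases eq_or_ne kl 0 with rfl | hkl
  · have hNC : (N : ℂ) ≠ 0 := by exact_mod_cast hN.ne'
    simp only [discrepancy, torusChar_zero]
    simp [hNC, hQ.le]
  · have hkl' : kl.1 ≠ 0 ∨ kl.2 ≠ 0 := by
      contrapose! hkl
      exact Prod.ext hkl.1 hkl.2
    simp only [discrepancy, integral_torusChar hkl', sub_zero, torusChar_mk_zpow]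
    rw [norm_div, Complex.norm_natCast, div_le_iff₀ hN']
    refine (norm_sum_Icc_fourierChar_le (by positivity) (hrel _ _ hkl' hk hl).le).trans_eq ?_
    field_simp

theorem norm_discrepancy_le_of_hasCentralFrequency_zero (hN : 0 < N) (hM : 0 < M) (hMQ : M ≤ Q)
    (hrel : NoIntegerRelation a.x a.z Q (Q / N)) (hB : ∀ p, ‖Φ p‖ ≤ 1)
    (hΦ : SMulLipschitz 1 Φ) (h₀ : HasCentralFrequency 0 Φ) :
    ‖discrepancy nilHaar (fun n => QuotientGroup.mk (a ^ n)) N Φ‖ ≤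
      2 * (2 / √M) + 2 * M ^ 2 / Q := by
  have hQ : 0 < Q := lt_of_lt_of_le (by exact_mod_cast hM) hMQ
  have happrox := fun p => hΦ.norm_sub_sum_torusChar_le h₀ hM p
  rw [mul_one] at happrox
  refine (norm_discrepancy_le_of_approx (hΦ.integrable hB) (fun kl _ => integrable_torusChar kl)
    happrox (fun kl hkl => norm_horizontalCoeff_le hB hkl) fun kl hkl => ?_).trans
    (add_le_add_right (?_ : _ * (1 / (2 * Q)) ≤ _) _)
  · obtain ⟨hk, hl⟩ := abs_lt_of_mem_frequencyBox hkl
    exact norm_discrepancy_torusChar_le hN hQ hrel (hk.le.trans hMQ) (hl.le.trans hMQ)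
  · refine (mul_le_mul_of_nonneg_right (card_frequencyBox_le M) (by positivity)).trans_eq ?_
    field_simp
    norm_num

end

/-! ### Correlations along orbits -/

theorem zpow_mul_eq (a b : Heis) (n : ℤ) :
    a ^ n * b = cen (n * (a.x * b.z - a.z * b.x)) * (b * a ^ n) := by
  ext <;> simp only [mul_x, mul_y, mul_z, cen_x, cen_y, cen_z, zpow_x, zpow_z] <;> ring

section

variable {Φ : Nil → ℂ} {L : ℝ}

theorem norm_sum_fourierChar_mul_le {a : Heis} {N M : ℕ} {D r : ℝ} (hM : 0 < M)
    (hB : ∀ p, ‖Φ p‖ ≤ 1) (hΦ : SMulLipschitz L Φ) (h₀ : HasCentralFrequency 0 Φ) {s : Finset ℤ}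
    (hs : s.card ≤ N)
    (hD : ∀ kl ∈ frequencyBox M, ‖∑ n ∈ s, (𝐞 (n * (r + (kl.1 * a.x + kl.2 * a.z))) : ℂ)‖ ≤ D) :
    ‖∑ n ∈ s, 𝐞 (n * r) * Φ (QuotientGroup.mk (a ^ n))‖ ≤
      N * (2 * L / √M) + (frequencyBox M).card * D := by
  set P : Nil → ℂ := fun p => ∑ kl ∈ frequencyBox M, horizontalCoeff M Φ kl * torusChar kl p
  have hP : ∑ n ∈ s, 𝐞 (n * r) * P (QuotientGroup.mk (a ^ n)) = ∑ kl ∈ frequencyBox M,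
      horizontalCoeff M Φ kl * ∑ n ∈ s, (𝐞 (n * (r + (kl.1 * a.x + kl.2 * a.z))) : ℂ) := by
    simp only [P, torusChar_mk_zpow, Finset.mul_sum, mul_add, coe_fourierChar_add]
    rw [Finset.sum_comm]
    exact Finset.sum_congr rfl fun _ _ => Finset.sum_congr rfl fun _ _ => mul_left_comm _ _ _
  have hsplit : ∑ n ∈ s, 𝐞 (n * r) * Φ (QuotientGroup.mk (a ^ n)) =
      ∑ n ∈ s, 𝐞 (n * r) * (Φ (QuotientGroup.mk (a ^ n)) - P (QuotientGroup.mk (a ^ n))) +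
        ∑ n ∈ s, 𝐞 (n * r) * P (QuotientGroup.mk (a ^ n)) := by
    rw [← Finset.sum_add_distrib]
    exact Finset.sum_congr rfl fun _ _ => by ring
  rw [hsplit, hP]
  refine (norm_add_le _ _).trans (add_le_add ?_ ?_)
  · refine (norm_sum_le_of_le s (n := fun _ => 2 * L / √M) fun n _ => ?_).trans ?_
    · rw [norm_mul, Circle.norm_coe, one_mul]
      exact hΦ.norm_sub_sum_torusChar_le h₀ hM _
    · have hL := hΦ.nonneg
      rw [Finset.sum_const, nsmul_eq_mul]
      gcongr
  · rw [← nsmul_eq_mul, ← Finset.sum_const]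
    refine norm_sum_le_of_le _ fun kl hkl => ?_
    rw [norm_mul]
    exact (mul_le_of_le_one_left (norm_nonneg _) (norm_horizontalCoeff_le hB hkl)).trans (hD kl hkl)

end

section

variable {f : Nil → ℂ} {ξ : ℤ}

theorem HasCentralFrequency.correlation (hf : HasCentralFrequency ξ f) (b : Heis) :
    HasCentralFrequency 0 fun p => f (b • p) * star (f p) := by
  intro c p
  have hphase : (𝐞 (ξ * c) : ℂ) * star (𝐞 (ξ * c) : ℂ) = 1 := by
    rw [← coe_fourierChar_neg, ← coe_fourierChar_add, add_neg_cancel]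
    simp
  simp only [← cen_smul_comm, hf c, star_mul, Int.cast_zero, zero_mul, AddChar.map_zero_eq_one,
    Circle.coe_one]
  linear_combination f (b • p) * star (f p) * hphase

theorem norm_mul_star_le_one (hB : ∀ p, ‖f p‖ ≤ 1) (p q : Nil) : ‖f p * star (f q)‖ ≤ 1 := by
  rw [norm_mul, norm_star]
  exact mul_le_one₀ (hB p) (norm_nonneg _) (hB q)

theorem SMulLipschitz.correlation {L : ℝ} (hB : ∀ p, ‖f p‖ ≤ 1) (hf : SMulLipschitz L f) {b : Heis}
    (hx : |b.x| ≤ 1) (hz : |b.z| ≤ 1) : SMulLipschitz (4 * L) fun p => f (b • p) * star (f p) := by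
  intro u p
  have hleft : ‖f (b • u • p) - f (b • p)‖ ≤ L * (3 * ‖psi u‖) := by
    have h := hf (b * u * b⁻¹) (b • p)
    rw [smul_smul, inv_mul_cancel_right, ← smul_smul] at h
    exact h.trans (mul_le_mul_of_nonneg_left (norm_psi_conj_le hx hz u) hf.nonneg)
  have hsplit : f (b • u • p) * star (f (u • p)) - f (b • p) * star (f p) =
      (f (b • u • p) - f (b • p)) * star (f (u • p)) + f (b • p) * star (f (u • p) - f p) := by
    rw [star_sub]
    ring
  simp only [hsplit]
  refine (norm_add_le _ _).trans ?_
  rw [norm_mul, norm_mul, norm_star, norm_star]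
  have h₁ := (mul_le_of_le_one_right (norm_nonneg _) (hB (u • p))).trans hleft
  have h₂ := (mul_le_of_le_one_left (norm_nonneg _) (hB (b • p))).trans (hf u p)
  linarith

theorem exists_fract_representative (g : Heis) : ∃ b : Heis, b.x = Int.fract g.x ∧
    b.z = Int.fract g.z ∧ (QuotientGroup.mk g : Nil) = QuotientGroup.mk b := by
  have hγ : (⟨(-⌊g.x⌋ : ℤ), 0, (-⌊g.z⌋ : ℤ)⟩ : Heis) ∈ Γ := ⟨⟨_, rfl⟩, ⟨0, by simp⟩, ⟨_, rfl⟩⟩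
  refine ⟨g * _, ?_, ?_, (QuotientGroup.mk_mul_of_mem g hγ).symm⟩
  · rw [mul_x, Int.fract]; push_cast; ring
  · rw [mul_z, Int.fract]; push_cast; ring

theorem HasCentralFrequency.exists_apply_zpow_add (hf : HasCentralFrequency ξ f) (a : Heis)
    (h : ℤ) : ∃ b : Heis, |b.x| ≤ 1 ∧ |b.z| ≤ 1 ∧ ∀ n : ℤ, f (QuotientGroup.mk (a ^ (n + h))) =
      𝐞 (n * (ξ * bracketForm a.x a.z h)) * f (b • (QuotientGroup.mk (a ^ n) : Nil)) := by
  obtain ⟨b, hx, hz, hb⟩ := exists_fract_representative (a ^ h)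
  rw [zpow_x] at hx
  rw [zpow_z] at hz
  have habs : ∀ t : ℝ, |Int.fract t| ≤ 1 := fun t =>
    (abs_of_nonneg (Int.fract_nonneg t)).trans_le (Int.fract_lt_one t).le
  refine ⟨b, hx ▸ habs _, hz ▸ habs _, fun n => ?_⟩
  rw [zpow_add, ← smul_mk, hb, smul_mk, zpow_mul_eq, ← smul_mk, hf, smul_mk, hx, hz, bracketForm]
  ring_nf

theorem HasCentralFrequency.norm_autocorrelation_le (hf : HasCentralFrequency ξ f) {L D : ℝ}
    {a : Heis} {N M : ℕ} {h : ℤ} (hM : 0 < M) (hB : ∀ p, ‖f p‖ ≤ 1) (hL : SMulLipschitz L f)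
    (hD : ∀ kl ∈ frequencyBox M, ‖∑ n ∈ Finset.Icc (max 1 (1 - h)) (min (N : ℤ) (N - h)),
      (𝐞 (n * (ξ * bracketForm a.x a.z h + (kl.1 * a.x + kl.2 * a.z))) : ℂ)‖ ≤ D) :
    ‖autocorrelation (fun n => f (QuotientGroup.mk (a ^ n))) N h‖ ≤
      N * (2 * (4 * L) / √M) + (frequencyBox M).card * D := by
  obtain ⟨b, hx, hz, hb⟩ := hf.exists_apply_zpow_add a h
  have hcard : (Finset.Icc (max 1 (1 - h)) (min (N : ℤ) (N - h))).card ≤ N := by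
    rw [Int.card_Icc]
    omega
  simp only [autocorrelation, hb, mul_assoc]
  exact norm_sum_fourierChar_mul_le hM (fun p => norm_mul_star_le_one hB _ _)
    (hL.correlation hB hx hz) (hf.correlation b) hcard hD

/-! ### Functions of nonzero central frequency -/

/-- The shifts `h` for which some phase occurring in the autocorrelation at `h` of a function of
central frequency `ξ` is too close to an integer for the resulting geometric sum to be small. -/
def badShifts (a : Heis) (ξ : ℤ) (N M : ℕ) : Finset ℤ :=
  (frequencyBox M).biUnion fun kl => {h ∈ Finset.Ioo (-(N : ℤ)) N |
    ‖((ξ * bracketForm a.x a.z h + (kl.1 * a.x + kl.2 * a.z) : ℝ) : UnitAddCircle)‖ ≤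
      (M : ℝ) ^ 3 / N}

variable {a : Heis} {N M : ℕ}

theorem card_filter_bracketForm_le (hN : 0 < N) (hM : 0 < M) (hξ : ξ ≠ 0) (hξM : |(ξ : ℝ)| ≤ M)
    (hrel : NoIntegerRelation a.x a.z (18 * (M : ℝ) ^ 9) (18 * (M : ℝ) ^ 9 / N)) (β : ℝ) :
    ({h ∈ Finset.Ioo (-(N : ℤ)) N |
      ‖((ξ * bracketForm a.x a.z h + β : ℝ) : UnitAddCircle)‖ ≤ (M : ℝ) ^ 3 / N}.card : ℝ) ≤
        32 * N / (M ^ 3 : ℕ) := by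
  have hN' : (0 : ℝ) < N := by exact_mod_cast hN
  have hM' : (1 : ℝ) ≤ M := by exact_mod_cast hM
  have hM₀ : (0 : ℝ) < M := by linarith
  have h₆ : (1 : ℝ) ≤ (M : ℝ) ^ 6 := one_le_pow₀ hM'
  have hQ : |(ξ : ℝ)| * (1 + 8 * ((M ^ 3 : ℕ) : ℝ) ^ 2) ≤ 18 * (M : ℝ) ^ 9 := by
    push_cast
    calc |(ξ : ℝ)| * (1 + 8 * ((M : ℝ) ^ 3) ^ 2) ≤ M * ((M : ℝ) ^ 6 + 8 * ((M : ℝ) ^ 3) ^ 2) := by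
          gcongr
      _ = 9 * (M : ℝ) ^ 7 := by ring
      _ ≤ 18 * (M : ℝ) ^ 9 := by
          gcongr
          · norm_num
          · norm_num
  have hρ : (2 + 16 * ((M ^ 3 : ℕ) : ℝ) ^ 2) * ((M : ℝ) ^ 3 / N) ≤ 18 * (M : ℝ) ^ 9 / N := by
    rw [mul_div_assoc']
    refine div_le_div_of_nonneg_right ?_ hN'.le
    push_cast
    nlinarith [pow_pos hM₀ 3]
  have hK : 8 * ((M ^ 3 : ℕ) : ℝ) ^ 3 ≤ 18 * (M : ℝ) ^ 9 / N * N := by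
    rw [div_mul_cancel₀ _ hN'.ne']
    push_cast
    nlinarith [pow_pos hM₀ 9]
  exact card_bracketForm_le (by positivity) hξ hrel hQ hρ hK (Finset.filter_subset _ _)
    fun h hh => (Finset.mem_filter.1 hh).2

theorem card_badShifts_le (hN : 0 < N) (hM : 0 < M) (hξ : ξ ≠ 0) (hξM : |(ξ : ℝ)| ≤ M)
    (hrel : NoIntegerRelation a.x a.z (18 * (M : ℝ) ^ 9) (18 * (M : ℝ) ^ 9 / N)) :
    ((badShifts a ξ N M).card : ℝ) ≤ 128 * N / M := by
  calc ((badShifts a ξ N M).card : ℝ)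
      ≤ (frequencyBox M).card * (32 * N / (M ^ 3 : ℕ)) := by
        refine (Nat.cast_le.2 Finset.card_biUnion_le).trans ?_
        rw [Nat.cast_sum, ← nsmul_eq_mul, ← Finset.sum_const]
        exact Finset.sum_le_sum fun kl _ => card_filter_bracketForm_le hN hM hξ hξM hrel _
    _ ≤ 4 * M ^ 2 * (32 * N / (M ^ 3 : ℕ)) := by
        gcongr
        exact card_frequencyBox_le M
    _ = 128 * N / M := by
        push_cast
        field_simp
        norm_num

theorem HasCentralFrequency.norm_autocorrelation_le_of_notMem_badShifts
    (hf : HasCentralFrequency ξ f) (hN : 0 < N) (hM : 0 < M) (hB : ∀ p, ‖f p‖ ≤ 1)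
    (hL : SMulLipschitz 1 f) {h : ℤ} (hh : h ∈ Finset.Ioo (-(N : ℤ)) N)
    (hbad : h ∉ badShifts a ξ N M) :
    ‖autocorrelation (fun n => f (QuotientGroup.mk (a ^ n))) N h‖ ≤
      N * (8 / √M) + 2 * N / M := by
  have hD : ∀ kl ∈ frequencyBox M, ‖∑ n ∈ Finset.Icc (max 1 (1 - h)) (min (N : ℤ) (N - h)),
      (𝐞 (n * (ξ * bracketForm a.x a.z h + (kl.1 * a.x + kl.2 * a.z))) : ℂ)‖ ≤
        1 / (2 * ((M : ℝ) ^ 3 / N)) := fun kl hkl => by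
    refine norm_sum_Icc_fourierChar_le (by positivity) ?_
    contrapose! hbad
    exact Finset.mem_biUnion.2 ⟨kl, hkl, Finset.mem_filter.2 ⟨hh, hbad.le⟩⟩
  calc ‖autocorrelation (fun n => f (QuotientGroup.mk (a ^ n))) N h‖
      ≤ N * (2 * (4 * 1) / √M) + (frequencyBox M).card * (1 / (2 * ((M : ℝ) ^ 3 / N))) :=
        hf.norm_autocorrelation_le hM hB hL hD
    _ ≤ N * (2 * (4 * 1) / √M) + 4 * M ^ 2 * (1 / (2 * ((M : ℝ) ^ 3 / N))) := by
        gcongr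
        exact card_frequencyBox_le M
    _ = N * (8 / √M) + 2 * N / M := by
        field_simp
        ring

theorem HasCentralFrequency.norm_sum_sq_le (hf : HasCentralFrequency ξ f) (hN : 0 < N)
    (hM : 0 < M) (hξ : ξ ≠ 0) (hξM : |(ξ : ℝ)| ≤ M)
    (hrel : NoIntegerRelation a.x a.z (18 * (M : ℝ) ^ 9) (18 * (M : ℝ) ^ 9 / N))
    (hB : ∀ p, ‖f p‖ ≤ 1) (hL : SMulLipschitz 1 f) :
    ‖∑ n ∈ Finset.Icc (1 : ℤ) N, f (QuotientGroup.mk (a ^ n))‖ ^ 2 ≤ 148 * N ^ 2 / √M := by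
  have hM' : (1 : ℝ) ≤ M := by exact_mod_cast hM
  have hinv : 1 / (M : ℝ) ≤ 1 / √M :=
    one_div_le_one_div_of_le (by positivity) (Real.sqrt_le_left (by linarith) |>.2 (by nlinarith))
  calc ‖∑ n ∈ Finset.Icc (1 : ℤ) N, f (QuotientGroup.mk (a ^ n))‖ ^ 2
      ≤ 2 * N * (N * (8 / √M) + 2 * N / M) + (badShifts a ξ N M).card * N :=
        norm_sum_sq_le_of_norm_autocorrelation_le (fun _ => hB _) (by positivity) fun h hh hbad =>
          hf.norm_autocorrelation_le_of_notMem_badShifts hN hM hB hL hh hbad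
    _ ≤ 2 * N * (N * (8 / √M) + 2 * N / M) + 128 * N / M * N := by
        gcongr
        exact card_badShifts_le hN hM hξ hξM hrel
    _ = (N : ℝ) ^ 2 * (16 * (1 / √M) + 132 * (1 / M)) := by ring
    _ ≤ (N : ℝ) ^ 2 * (16 * (1 / √M) + 132 * (1 / √M)) := by gcongr
    _ = 148 * N ^ 2 / √M := by ring

end

/-! ### Equidistribution of horizontally irrational orbits -/

section

variable {a : Heis} {N m : ℕ} {f : Nil → ℂ}

/- With `M = m ^ 12` the error terms `1 / √M` and `1 / √(√M)` of the two cases below are `1 / m ^ 6`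
and `1 / m ^ 3`, which leaves room to sum over the `2 m` central frequencies. -/
theorem sqrt_pow_twelve (m : ℕ) : √((m ^ 12 : ℕ) : ℝ) = (m : ℝ) ^ 6 := by
  rw [Nat.cast_pow, show (m : ℝ) ^ 12 = ((m : ℝ) ^ 6) ^ 2 by ring, Real.sqrt_sq (by positivity)]

theorem HasCentralFrequency.norm_discrepancy_le_of_eq_zero (hf : HasCentralFrequency 0 f)
    (hN : 0 < N) (hm : 0 < m) (hrel : NoIntegerRelation a.x a.z (18 * ((m ^ 12 : ℕ) : ℝ) ^ 9)
      (18 * ((m ^ 12 : ℕ) : ℝ) ^ 9 / N)) (hB : ∀ p, ‖f p‖ ≤ 1) (hL : SMulLipschitz 1 f) :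
    ‖discrepancy nilHaar (fun n => QuotientGroup.mk (a ^ n)) N f‖ ≤ 13 / m ^ 3 := by
  have hm' : (1 : ℝ) ≤ m := by exact_mod_cast hm
  set M := m ^ 12 with hM
  have hM₀ : 0 < M := by positivity
  have hM' : (1 : ℝ) ≤ M := by exact_mod_cast hM₀
  have hMQ : (M : ℝ) ≤ 18 * (M : ℝ) ^ 9 := by
    linarith [le_self_pow₀ hM' (by norm_num : (9 : ℕ) ≠ 0)]
  have hmM : (m : ℝ) ^ 3 ≤ (M : ℝ) ^ 7 := by
    rw [hM, Nat.cast_pow, ← pow_mul]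
    exact pow_le_pow_right₀ hm' (by norm_num)
  calc ‖discrepancy nilHaar (fun n => QuotientGroup.mk (a ^ n)) N f‖
      ≤ 2 * (2 / √M) + 2 * M ^ 2 / (18 * (M : ℝ) ^ 9) :=
        norm_discrepancy_le_of_hasCentralFrequency_zero hN hM₀ hMQ hrel hB hL hf
    _ = 4 * (1 / (m : ℝ) ^ 6) + 1 / 9 * (1 / (M : ℝ) ^ 7) := by
        rw [sqrt_pow_twelve]
        field_simp
        ring
    _ ≤ 4 * (1 / (m : ℝ) ^ 3) + 1 * (1 / (m : ℝ) ^ 3) := by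
        gcongr
        · norm_num
        · norm_num
    _ ≤ 13 / (m : ℝ) ^ 3 := by
        rw [← add_mul, mul_one_div]
        gcongr
        norm_num

theorem HasCentralFrequency.norm_discrepancy_le_of_ne_zero {ξ : ℤ} (hf : HasCentralFrequency ξ f)
    (hN : 0 < N) (hm : 0 < m) (hξ : ξ ≠ 0) (hξm : |(ξ : ℝ)| ≤ m)
    (hrel : NoIntegerRelation a.x a.z (18 * ((m ^ 12 : ℕ) : ℝ) ^ 9)
      (18 * ((m ^ 12 : ℕ) : ℝ) ^ 9 / N)) (hB : ∀ p, ‖f p‖ ≤ 1) (hL : SMulLipschitz 1 f) :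
    ‖discrepancy nilHaar (fun n => QuotientGroup.mk (a ^ n)) N f‖ ≤ 13 / m ^ 3 := by
  have hN' : (0 : ℝ) < N := by exact_mod_cast hN
  have : (1 : ℝ) ≤ m := by exact_mod_cast hm
  have hmM : (m : ℝ) ≤ (m ^ 12 : ℕ) := by
    exact_mod_cast Nat.le_self_pow (by norm_num : (12 : ℕ) ≠ 0) m
  have hsq := hf.norm_sum_sq_le hN (by positivity) hξ (hξm.trans hmM) hrel hB hL
  rw [discrepancy, hf.integral_eq_zero hξ, sub_zero, norm_div, Complex.norm_natCast,
    div_le_iff₀ hN']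
  refine le_of_sq_le_sq (hsq.trans ?_) (by positivity)
  rw [sqrt_pow_twelve, mul_pow, div_pow, div_mul_eq_mul_div, ← pow_mul]
  gcongr
  norm_num

theorem SMulLipschitz.norm_discrepancy_zpow_le {F : Nil → ℂ} (hF : SMulLipschitz 1 F) (hN : 0 < N)
    (hm : 0 < m) (hrel : NoIntegerRelation a.x a.z (18 * ((m ^ 12 : ℕ) : ℝ) ^ 9)
      (18 * ((m ^ 12 : ℕ) : ℝ) ^ 9 / N)) (hB : ∀ p, ‖F p‖ ≤ 1) :
    ‖discrepancy nilHaar (fun n => QuotientGroup.mk (a ^ n)) N F‖ ≤ 28 / √m := by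
  have hm' : (1 : ℝ) ≤ m := by exact_mod_cast hm
  have hcomponent : ∀ ξ ∈ Finset.Ioo (-(m : ℤ)) m,
      ‖discrepancy nilHaar (fun n => QuotientGroup.mk (a ^ n)) N (Heis.centralComponent ξ F)‖ ≤
        13 / m ^ 3 := by
    intro ξ hξ
    have hf := hF.hasCentralFrequency_centralComponent ξ
    have hB' := norm_centralComponent_le hB ξ
    rcases eq_or_ne ξ 0 with rfl | hξ₀
    · exact hf.norm_discrepancy_le_of_eq_zero hN hm hrel hB' (hF.centralComponent 0)
    · have hξm : |(ξ : ℝ)| < m := by exact_mod_cast abs_lt.2 (Finset.mem_Ioo.1 hξ)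
      exact hf.norm_discrepancy_le_of_ne_zero hN hm hξ₀ hξm.le hrel hB' (hF.centralComponent ξ)
  have hsqrt : √(m : ℝ) ≤ (m : ℝ) ^ 2 :=
    Real.sqrt_le_left (by positivity) |>.2 (le_self_pow₀ hm' two_ne_zero |>.trans
      (le_self_pow₀ (one_le_pow₀ hm') two_ne_zero))
  calc ‖discrepancy nilHaar (fun n => QuotientGroup.mk (a ^ n)) N F‖
      ≤ 2 * (1 / √m) + (Finset.Ioo (-(m : ℤ)) m).card * (13 / m ^ 3) :=
        norm_discrepancy_le_of_approx (hF.integrable hB)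
          (fun ξ _ => (hF.centralComponent ξ).integrable (norm_centralComponent_le hB ξ))
          (fun p => hF.norm_sub_sum_centralComponent_le hm p)
          (fun ξ hξ => norm_fejerCoeff_le_one hξ) hcomponent
    _ ≤ 2 * (1 / √m) + 2 * m * (13 / m ^ 3) := by
        gcongr
        exact card_Ioo_neg_le m
    _ = 2 * (1 / √m) + 26 * (1 / m ^ 2) := by
        field_simp
        ring
    _ ≤ 2 * (1 / √m) + 26 * (1 / √m) := by gcongr
    _ = 28 / √m := by ring

end

/-! ### The Lipschitz norm -/

theorem heisDist_nonneg (x y : Heis) : 0 ≤ heisDist x y := by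
  refine Real.sInf_nonneg ?_
  rintro r ⟨n, c, -, -, rfl⟩
  exact Finset.sum_nonneg fun i _ => le_min (norm_nonneg _) (norm_nonneg _)

theorem heisDist_le (x y : Heis) : heisDist x y ≤ ‖psi (x * y⁻¹)‖ := by
  have hmin : heisDist x y ≤ min ‖psi (x * y⁻¹)‖ ‖psi (y * x⁻¹)‖ := by
    refine csInf_le ⟨0, ?_⟩ ⟨1, fun i => if i = 0 then x else y, by simp, by simp, by simp⟩
    rintro r ⟨n, c, -, -, rfl⟩
    exact Finset.sum_nonneg fun i _ => le_min (norm_nonneg _) (norm_nonneg _)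
  exact hmin.trans (min_le_left _ _)

theorem nilDist_nonneg (p q : Nil) : 0 ≤ nilDist p q := by
  refine Real.sInf_nonneg ?_
  rintro r ⟨x, y, -, -, rfl⟩
  exact heisDist_nonneg x y

theorem nilDist_smul_le (u : Heis) (p : Nil) : nilDist (u • p) p ≤ ‖psi u‖ := by
  induction p using QuotientGroup.induction_on with
  | H g =>
    have h : nilDist (u • (QuotientGroup.mk g : Nil)) (QuotientGroup.mk g) ≤
        heisDist (u * g) g := by
      refine csInf_le ⟨0, ?_⟩ ⟨u * g, g, rfl, rfl, rfl⟩
      rintro r ⟨x, y, -, -, rfl⟩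
      exact heisDist_nonneg x y
    exact h.trans ((heisDist_le _ _).trans_eq (by rw [mul_inv_cancel_right]))

theorem exists_bounded_representative (p : Nil) :
    ∃ b : Heis, ‖psi b‖ ≤ 2 ∧ b • (QuotientGroup.mk 1 : Nil) = p := by
  induction p using QuotientGroup.induction_on with
  | H g =>
    obtain ⟨b, hx, hz, hb⟩ := exists_fract_representative g
    refine ⟨cen (-⌊b.y⌋ : ℤ) * b, ?_, ?_⟩
    · have hx₀ := Int.fract_nonneg g.x
      have hx₁ := Int.fract_lt_one g.x
      have hz₀ := Int.fract_nonneg g.z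
      have hz₁ := Int.fract_lt_one g.z
      have hy₀ := Int.fract_nonneg b.y
      have hy₁ := Int.fract_lt_one b.y
      rw [← hx] at hx₀ hx₁
      rw [← hz] at hz₀ hz₁
      have hy : (cen (-⌊b.y⌋ : ℤ) * b).y = Int.fract b.y := by
        simp only [mul_y, cen_x, cen_y, Int.fract]
        push_cast
        ring
      refine norm_psi_le two_pos.le ?_ ?_ ?_
      · rw [mul_x, cen_x, zero_add, abs_le]
        constructor <;> linarith
      · rw [mul_z, cen_z, zero_add, abs_le]
        constructor <;> linarith
      · rw [hy, mul_x, cen_x, zero_add, mul_z, cen_z, zero_add, abs_le]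
        constructor <;> nlinarith
    · rw [smul_mk, mul_one, cen_mul_comm, QuotientGroup.mk_mul_of_mem _ (cen_intCast_mem _), hb]

section

variable {F : Nil → ℂ}

theorem IsLipschitz.exists_smulLipschitz (hF : IsLipschitz F) : ∃ L, SMulLipschitz L F := by
  obtain ⟨K, hK⟩ := hF
  refine ⟨|K|, fun u p => (hK _ _).trans ?_⟩
  exact mul_le_mul (le_abs_self K) (nilDist_smul_le u p) (nilDist_nonneg _ _) (abs_nonneg K)

theorem IsLipschitz.bddAbove_range_norm (hF : IsLipschitz F) :
    BddAbove (Set.range fun p : Nil => ‖F p‖) := by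
  obtain ⟨L, hL⟩ := hF.exists_smulLipschitz
  refine ⟨L * 2 + ‖F (QuotientGroup.mk 1)‖, ?_⟩
  rintro _ ⟨p, rfl⟩
  obtain ⟨b, hb, rfl⟩ := exists_bounded_representative p
  have hmove := (hL b (QuotientGroup.mk 1)).trans (mul_le_mul_of_nonneg_left hb hL.nonneg)
  have htri := norm_sub_norm_le (F (b • (QuotientGroup.mk 1 : Nil))) (F (QuotientGroup.mk 1))
  simp only
  linarith

theorem IsLipschitz.bddAbove_range_quotient (hF : IsLipschitz F) :
    BddAbove (Set.range fun pq : {pq : Nil × Nil // pq.1 ≠ pq.2} =>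
      ‖F pq.1.1 - F pq.1.2‖ / nilDist pq.1.1 pq.1.2) := by
  obtain ⟨K, hK⟩ := hF
  refine ⟨|K|, ?_⟩
  rintro _ ⟨pq, rfl⟩
  refine div_le_of_le_mul₀ (nilDist_nonneg _ _) (abs_nonneg K) ((hK _ _).trans ?_)
  exact mul_le_mul_of_nonneg_right (le_abs_self K) (nilDist_nonneg _ _)

theorem iSup_quotient_nonneg (F : Nil → ℂ) :
    0 ≤ ⨆ pq : {pq : Nil × Nil // pq.1 ≠ pq.2},
      ‖F pq.1.1 - F pq.1.2‖ / nilDist pq.1.1 pq.1.2 :=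
  Real.iSup_nonneg fun _ => div_nonneg (norm_nonneg _) (nilDist_nonneg _ _)

theorem IsLipschitz.norm_le_lipNorm (hF : IsLipschitz F) (p : Nil) : ‖F p‖ ≤ lipNorm F :=
  (le_ciSup hF.bddAbove_range_norm p).trans (le_add_of_nonneg_right (iSup_quotient_nonneg F))

theorem IsLipschitz.norm_sub_le_lipNorm_mul (hF : IsLipschitz F) (p q : Nil) :
    ‖F p - F q‖ ≤ lipNorm F * nilDist p q := by
  have hlip : 0 ≤ lipNorm F := (norm_nonneg _).trans (hF.norm_le_lipNorm p)
  rcases eq_or_ne p q with rfl | hpq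
  · rw [sub_self, norm_zero]
    exact mul_nonneg hlip (nilDist_nonneg _ _)
  rcases (nilDist_nonneg p q).eq_or_lt with hdist | hdist
  · obtain ⟨K, hK⟩ := hF
    simpa [← hdist] using hK p q
  · rw [← div_le_iff₀ hdist]
    exact (le_ciSup hF.bddAbove_range_quotient ⟨(p, q), hpq⟩).trans
      (le_add_of_nonneg_left (Real.iSup_nonneg fun _ => norm_nonneg _))

theorem IsLipschitz.smulLipschitz_lipNorm (hF : IsLipschitz F) : SMulLipschitz (lipNorm F) F :=
  fun u p => (hF.norm_sub_le_lipNorm_mul _ _).trans <| mul_le_mul_of_nonneg_left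
    (nilDist_smul_le u p) ((norm_nonneg _).trans (hF.norm_le_lipNorm p))

theorem isEquidistributed_of_normalized {g : ℤ → Heis} {N : ℕ} {δ : ℝ}
    (h : ∀ F : Nil → ℂ, (∀ p, ‖F p‖ ≤ 1) → SMulLipschitz 1 F →
      ‖discrepancy nilHaar (fun n => QuotientGroup.mk (g n)) N F‖ ≤ δ) :
    IsEquidistributed g N δ := by
  intro F hF
  change ‖discrepancy nilHaar (fun n => QuotientGroup.mk (g n)) N F‖ ≤ δ * lipNorm F
  have hB := hF.norm_le_lipNorm
  have hL := hF.smulLipschitz_lipNorm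
  set r := lipNorm F
  rcases hL.nonneg.eq_or_lt with hr | hr
  · rw [← hr] at hB ⊢
    simpa using norm_discrepancy_le (μ := nilHaar) hB
  · have hnorm : ‖(r : ℂ)⁻¹‖ = r⁻¹ := by
      rw [norm_inv, Complex.norm_real, Real.norm_of_nonneg hr.le]
    have hunit := h (fun p => (r : ℂ)⁻¹ * F p)
      (fun p => by rw [norm_mul, hnorm, inv_mul_le_iff₀ hr, mul_one]; exact hB p)
      (fun u p => by rw [← mul_sub, norm_mul, hnorm, inv_mul_le_iff₀ hr, one_mul]; exact hL u p)
    rwa [discrepancy_const_mul, norm_mul, hnorm, inv_mul_le_iff₀ hr, mul_comm] at hunit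

end

/-! ### Horizontal characters -/

/-- The horizontal character of frequency `(k, l, 0)`. -/
def horizontalCharacter (k l : ℤ) : HorizontalCharacter where
  toFun g := ((k * g.x + l * g.z : ℝ) : UnitAddCircle)
  map_mul' g h := by
    rw [← AddCircle.coe_add, mul_x, mul_z]
    ring_nf
  continuous_toFun := by
    have := continuous_x
    have := continuous_z
    exact (AddCircle.continuous_mk' 1).comp (by fun_prop)
  annihilates := by
    rintro γ ⟨⟨m, hm⟩, -, ⟨n, hn⟩⟩
    rw [hm, hn, AddCircle.coe_eq_zero_iff]
    exact ⟨k * m + l * n, by simp⟩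

theorem modulus_horizontalCharacter (k l : ℤ) :
    (horizontalCharacter k l).modulus = ‖(![k, l, 0] : Fin 3 → ℤ)‖ := by
  refine HorizontalCharacter.modulus_eq fun g => ?_
  simp [horizontalCharacter, psi, Fin.sum_univ_three]

theorem exists_horizontalCharacter_of_not_noIntegerRelation {a : Heis} {Q r : ℝ}
    (h : ¬NoIntegerRelation a.x a.z Q r) : ∃ η : HorizontalCharacter,
      0 < η.modulus ∧ η.modulus ≤ Q ∧ ‖η.toFun a‖ ≤ r := by
  unfold NoIntegerRelation at h
  push Not at h
  obtain ⟨k, l, hkl, hk, hl, hr⟩ := h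
  refine ⟨horizontalCharacter k l, ?_, ?_, hr⟩
  · rw [modulus_horizontalCharacter, norm_pos_iff]
    intro hzero
    exact hkl.elim (· (congrFun hzero 0)) (· (congrFun hzero 1))
  · rw [modulus_horizontalCharacter, pi_norm_le_iff_of_nonneg ((abs_nonneg _).trans hk)]
    intro i
    fin_cases i
    · simpa [Int.norm_eq_abs] using hk
    · simpa [Int.norm_eq_abs] using hl
    · simpa using (abs_nonneg _).trans hk

theorem exists_nat_div_sqrt_le {δ : ℝ} (hδ : 0 < δ) (hδ₂ : δ < 2) : ∃ m : ℕ, 0 < m ∧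
    28 / √m ≤ δ ∧ 18 * ((m ^ 12 : ℕ) : ℝ) ^ 9 ≤ 18 * 788 ^ 108 * δ ^ (-(216 : ℝ)) := by
  have hpos : 0 < 784 / δ ^ 2 := by positivity
  have hm : 0 < ⌈784 / δ ^ 2⌉₊ := Nat.ceil_pos.2 hpos
  have hupper : (⌈784 / δ ^ 2⌉₊ : ℝ) ≤ 788 / δ ^ 2 := by
    refine (Nat.ceil_lt_add_one hpos.le).le.trans ?_
    rw [div_add_one (by positivity), div_le_div_iff_of_pos_right (by positivity)]
    nlinarith
  have hlower : 28 / δ ≤ √(⌈784 / δ ^ 2⌉₊ : ℝ) := by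
    refine Real.le_sqrt_of_sq_le (le_trans (le_of_eq ?_) (Nat.le_ceil _))
    rw [div_pow]
    norm_num
  have hrpow : δ ^ (-(216 : ℝ)) = (δ ^ 216)⁻¹ := by
    rw [Real.rpow_neg hδ.le]
    exact_mod_cast congrArg (·⁻¹) (Real.rpow_natCast δ 216)
  refine ⟨⌈784 / δ ^ 2⌉₊, hm, ?_, ?_⟩
  · rwa [div_le_comm₀ (Real.sqrt_pos.2 (by exact_mod_cast hm)) hδ]
  · rw [hrpow, Nat.cast_pow, ← pow_mul, mul_assoc]
    refine mul_le_mul_of_nonneg_left ?_ (by norm_num)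
    calc (⌈784 / δ ^ 2⌉₊ : ℝ) ^ (12 * 9) ≤ (788 / δ ^ 2) ^ (12 * 9) := by gcongr
      _ = 788 ^ 108 * (δ ^ 216)⁻¹ := by rw [div_pow, ← pow_mul, div_eq_mul_inv]

end Heis

end

theorem proposition5p1 :
    ∃ C A : ℝ, 0 < C ∧ 0 < A ∧
      ∀ (a : Heis) (δ : ℝ), 0 < δ → ∀ N : ℕ, 1 ≤ N →
        Heis.IsEquidistributed (fun n : ℤ => a ^ n) N δ ∨
        ∃ η : Heis.HorizontalCharacter,
          0 < η.modulus ∧ η.modulus ≤ C * δ ^ (-A) ∧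
          ‖η.toFun a‖ ≤ C * δ ^ (-A) / N := by
  refine ⟨18 * 788 ^ 108, 216, by positivity, by norm_num, fun a δ hδ N hN => ?_⟩
  rcases le_or_gt 2 δ with hδ₂ | hδ₂
  · exact .inl <| Heis.isEquidistributed_of_normalized fun F hB _ =>
      (norm_discrepancy_le hB).trans (by linarith)
  obtain ⟨m, hm, hsqrt, hQ⟩ := Heis.exists_nat_div_sqrt_le hδ hδ₂
  by_cases hrel : NoIntegerRelation a.x a.z (18 * ((m ^ 12 : ℕ) : ℝ) ^ 9)
      (18 * ((m ^ 12 : ℕ) : ℝ) ^ 9 / N)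
  · exact .inl <| Heis.isEquidistributed_of_normalized fun F hB hF =>
      (hF.norm_discrepancy_zpow_le hN hm hrel hB).trans hsqrt
  · obtain ⟨η, hpos, hle, ha⟩ := Heis.exists_horizontalCharacter_of_not_noIntegerRelation hrel
    exact .inr ⟨η, hpos, hle.trans hQ, ha.trans (by gcongr)⟩
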